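/- Tensors and blocking. An MPO tensor $\mathcal V$ with input dimension $d_{\rm in}\ge 1$, output dimension $d_{\rm out}$, purification dimension $\chi$ and bond dimension $D$ is a family of $D\times D$ complex matrices $\mathcal V^{ik}$, where $i$ is the grouped output/purification index ($d_{\rm out}\chi$ values) and $k$ the input index. For $N\ge 1$ it generates the operator $V_N:(\mathbb C^{d_{\rm in}})^{\otimes N}\to(\mathbb C^{d_{\rm out}\chi})^{\otimes N}$ with entries $\operatorname{tr}(\mathcal V^{i_1k_1}\cdots\mathcal V^{i_Nk_N})$. The tensor $\mathcal V_q$ obtained by blocking $q$ sites is $\mathcal V_q^{(i_1\dots i_q)(k_1\dots k_q)}=\mathcal V^{i_1k_1}\cdots\mathcal V^{i_qk_q}$, and the operator it generates on $N$ blocks is $V_{qN}$. The tensor $\mathcal V$ generates an hMPI if $V_N^\dagger V_N=\mathbb 1$ for all $N\ge1$. It generates an sMPI with constant $c>0$ if $V_N^\dagger V_N=c\,\mathbb 1$ for all $N\ge 1$, with $c$ independent of $N$. Normal tensors. A tensor $\mathcal A$ with input index $k$ ranging over $d$ values is normal if the matrices $\mathcal A^{ik}$ have no common nontrivial invariant subspace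 and its transfer matrix $\frac1{d}\sum_{i,k}\overline{\mathcal A^{ik}}\otimes\mathcal A^{ik}$ has $1$ as a simple eigenvalue, all its other eigenvalues having modulus $<1$. A basis of normal tensors (BNT) for $\mathcal A$ is a finite family of normal tensors $\mathcal A_j$ such that $A_N\in\operatorname{span}\{A_{j,N}\}_j$ for every $N\ge 1$, and the $A_{j,N}$ are linearly independent for all sufficiently large $N$. Two tensors $\mathcal A,\mathcal B$ are strongly orthogonal if $\sum_i\overline{\mathcal A^{ik}}\otimes\mathcal B^{ik'}=0$ for all input values $k,k'$. A tensor is in canonical form if, up to a change of basis of the bond space, it equals $\bigoplus_k\mu_k\mathcal A_k$ with $\mu_k\ne0$ and normal tensors $\mathcal A_k$. Proposition. Let $\mathcal V$ generate an sMPI with constant $c$. Then there are a blocking length $q\ge1$, a number $g\le D$, integers $m_1,\dots,m_g\ge 1$, and tensors $\mathcal V_1,\dots,\mathcal V_g$ of bond dimensions $D_1,\dots,D_g$ with $\sum_j m_jD_j\le D$, with the same input and output index sets as $\mathcal V_q$, such that: 1. $\mathcal V_q$ and $\bigoplus_{j=1}^g(\mathbb 1_{m_j}\otimes\mathcal V_j)$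 generate the same operator for every system size $N\ge 1$. If $\mathcal V$ is in canonical form, then the two tensors are moreover equal up to an invertible change of basis of the bond space. 2. $\{\mathcal V_j\}_j$ is a BNT for $\mathcal V_q$; the $\mathcal V_j$ are pairwise strongly orthogonal, and each $\mathcal V_j$ generates an hMPI. 3. $\sum_j m_j^2=c$ and, for every $N\ge1$, the normalized operator satisfies $\frac1{\sqrt c}V_{qN}=\frac1{\sqrt c}\sum_{j}m_jV_{j,N}$, where $V_{i,N}^\dagger V_{j,N}=\delta_{ij}\mathbb 1$. -/

import Mathlib

open scoped Kronecker

/-- A matrix product operator (MPO) tensor with bond index `b`, (grouped) output index `O` and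
input index `I`: a matrix on the bond space for every output value and every input value. -/
abbrev MPOTensor (b O I : Type*) := O → I → Matrix b b ℂ

namespace MPOTensor

variable {b b' O I : Type*}

/-- The product of the matrices `A^{o₁ i₁} ⋯ A^{o_N i_N}` along a chain of `N` sites. -/
noncomputable def word [Fintype b] [DecidableEq b] (A : MPOTensor b O I) {N : ℕ}
    (o : Fin N → O) (i : Fin N → I) : Matrix b b ℂ :=
  (List.ofFn fun s => A (o s) (i s)).prod

/-- The operator `V_N` generated by repeating the tensor `N` times with periodic boundary. -/
noncomputable def mpo [Fintype b] [DecidableEq b] (A : MPOTensor b O I) (N : ℕ) :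
    Matrix (Fin N → O) (Fin N → I) ℂ :=
  fun o i => (A.word o i).trace

/-- Blocking: `q` consecutive copies of the tensor form one tensor with the same bond space. -/
noncomputable def block [Fintype b] [DecidableEq b] (A : MPOTensor b O I) (q : ℕ) :
    MPOTensor b (Fin q → O) (Fin q → I) :=
  fun o i => A.word o i

/-- `A` generates a homogeneous matrix product isometry. -/
def IsHMPI [Fintype b] [DecidableEq b] [Fintype O] [DecidableEq I] (A : MPOTensor b O I) : Prop :=
  ∀ N : ℕ, 1 ≤ N → (A.mpo N).conjTranspose * A.mpo N = 1

/-- `A` generates a scaled homogeneous matrix product isometry with constant `c`. -/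
def IsSMPI [Fintype b] [DecidableEq b] [Fintype O] [DecidableEq I] (A : MPOTensor b O I)
    (c : ℝ) : Prop :=
  0 < c ∧ ∀ N : ℕ, 1 ≤ N → (A.mpo N).conjTranspose * A.mpo N = (c : ℂ) • 1

/-- The contraction of `Ā` with `B` over the output index only; the two input indices stay open. -/
noncomputable def double [Fintype O] (A : MPOTensor b O I) (B : MPOTensor b' O I) (i i' : I) :
    Matrix (b × b') (b × b') ℂ :=
  ∑ o, (A o i).map star ⊗ₖ B o i'

/-- Strong orthogonality: the contraction over the output index alone vanishes. -/
def StronglyOrthogonal [Fintype O] (A : MPOTensor b O I) (B : MPOTensor b' O I) : Prop :=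
  ∀ i i' : I, double A B i i' = 0

/-- The transfer matrix `E`, normalized by the input dimension. -/
noncomputable def transfer [Fintype O] [Fintype I] (A : MPOTensor b O I) :
    Matrix (b × b) (b × b) ℂ :=
  (Fintype.card I : ℂ)⁻¹ • ∑ i, double A A i i

/-- Normal tensor, with respect to the normalized transfer matrix: (i) no nontrivial invariant
subspace; (ii) the transfer matrix has the simple eigenvalue `1`, and all its other eigenvalues
have modulus less than `1`. -/
def IsNormal [Fintype b] [DecidableEq b] [Fintype O] [Fintype I] (A : MPOTensor b O I) : Prop :=
  (∀ P : Matrix b b ℂ, IsIdempotentElem P → (∀ o i, A o i * P = P * A o i * P) →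
    P = 0 ∨ P = 1) ∧
  A.transfer.charpoly.rootMultiplicity 1 = 1 ∧
  ∀ z : ℂ, A.transfer.charpoly.IsRoot z → z = 1 ∨ ‖z‖ < 1

/-- `A_1, …, A_g` is a basis of normal tensors for `A`. -/
def IsBNT [Fintype b] [DecidableEq b] [Fintype O] [Fintype I] {g : ℕ} {d : Fin g → ℕ}
    (B : (j : Fin g) → MPOTensor (Fin (d j)) O I) (A : MPOTensor b O I) : Prop :=
  (∀ j, (B j).IsNormal) ∧
  (∀ N : ℕ, 1 ≤ N → A.mpo N ∈ Submodule.span ℂ (Set.range fun j => (B j).mpo N)) ∧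
  ∃ N₀ : ℕ, ∀ N : ℕ, N₀ < N → LinearIndependent ℂ fun j => (B j).mpo N

/-- The tensor `⊕_j (1_{m_j} ⊗ B_j)`. -/
noncomputable def multSum {g : ℕ} (m d : Fin g → ℕ) (B : (j : Fin g) → MPOTensor (Fin (d j)) O I) :
    MPOTensor ((j : Fin g) × (Fin (m j) × Fin (d j))) O I :=
  fun o i => Matrix.blockDiagonal' fun j => (1 : Matrix (Fin (m j)) (Fin (m j)) ℂ) ⊗ₖ B j o i

/-- The tensors differ by an invertible change of basis of the bond space. -/
def GaugeEquiv [Fintype b] [DecidableEq b] [Fintype b'] [DecidableEq b']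
    (A : MPOTensor b O I) (B : MPOTensor b' O I) : Prop :=
  ∃ (X : Matrix b b' ℂ) (Y : Matrix b' b ℂ), X * Y = 1 ∧ Y * X = 1 ∧
    ∀ o i, A o i = X * B o i * Y

/-- Up to a change of basis of the bond space, `A = ⊕_k μ_k A_k` with normal tensors `A_k` and
nonzero coefficients `μ_k`. -/
def HasCanonicalForm [Fintype b] [DecidableEq b] [Fintype O] [Fintype I]
    (A : MPOTensor b O I) : Prop :=
  ∃ (r : ℕ) (d : Fin r → ℕ) (μ : Fin r → ℂ) (B : (k : Fin r) → MPOTensor (Fin (d k)) O I),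
    (∀ k, μ k ≠ 0) ∧ (∀ k, (B k).IsNormal) ∧
    GaugeEquiv A (fun o i => Matrix.blockDiagonal' fun k => μ k • B k o i)

end MPOTensor

/-! The traces of all nonempty words in `V` are those of a direct sum of irreducible tensors `A k`
(`exists_irreducible_decomposition`, or the given blocks when `V` is in canonical form). The
condition `V_N† V_N = c 1` then says that the double tensors of the pairs `(k, l)`, viewed as
representations of the free algebra on the letters `(i, i')`, have total character `c φ` on nonempty
words, where `φ` is multiplicative and sends `(i, i')` to `δ_{ii'}`.

The main principle is `isNilpotent_freeRep`: an element of the free algebra without constant term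
and killed by `φ` has traceless powers in the whole sum, hence is nilpotent in every summand
separately. Applied to `word - φ(word) x`, with `x` the average of the diagonal letters, it gives
`A_k,N† A_l,N = tr(E_kl) 1` for each pair, `E_kl` being the mixed transfer matrix. Applied to `x ^ m
- x`, it puts the spectrum of `E_kl` in `{0, 1}`; in particular no phases can relate two blocks.

It remains to find `tr E_kl`. Irreducibility means that words span all matrices (Burnside), so
constancy of `tr E_kk^m`, a sum of squares, bounds the powers of `E_kk`, and these become stationary
(`IsFullFamily.exists_isStableFamily`). A fixed point of a mixed transfer map is an intertwiner
times the positive fixed point of `E_kk` (`exists_intertwiner`), so by Schur's lemma the stationary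
power of `E_kk` has rank one, and `tr E_kl` is `1` for gauge equivalent blocks and `0` otherwise.

Grouping the blocks into gauge classes of sizes `m_j` gives the multiplicities, orthonormality, and
`c = ∑ m_j²`. For blocks in different classes every nonempty word in the double tensor is traceless,
so long words vanish (`exists_wprod_eq_zero`); blocking therefore yields strong orthogonality along
with normality. -/

section

open Matrix

/-! ### Nilpotency from vanishing traces of powers. -/

/-- A complex matrix all of whose positive powers are traceless is nilpotent. -/
theorem Matrix.isNilpotent_of_trace_pow_eq_zero {n : Type*} [Fintype n] [DecidableEq n]
    (M : Matrix n n ℂ) (h : ∀ k : ℕ, 1 ≤ k → (M ^ k).trace = 0) : IsNilpotent M := by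
  have tr0 : ∀ p : Polynomial ℂ, p.coeff 0 = 0 → (Polynomial.aeval M p).trace = 0 := by
    intro p hp
    rw [Polynomial.aeval_eq_sum_range, Matrix.trace_sum]
    refine Finset.sum_eq_zero fun k _ => ?_
    rcases Nat.eq_zero_or_pos k with rfl | hk
    · simp [hp]
    · rw [Matrix.trace_smul, h k hk, smul_zero]
  have hne : M.charpoly ≠ 0 := M.charpoly_monic.ne_zero
  obtain ⟨g, hg, hdvd⟩ := Polynomial.exists_eq_pow_rootMultiplicity_mul_and_not_dvd _ hne 0
  set a := M.charpoly.rootMultiplicity 0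
  simp only [map_zero, sub_zero] at hg hdvd
  -- The Bézout element `e` projects onto the generalized eigenspaces of nonzero eigenvalues. The
  -- exponent `a + 1` instead of `a` makes it a polynomial without constant term even when `a = 0`,
  -- so that its trace vanishes.
  have hcop : IsCoprime (Polynomial.X ^ (a + 1) : Polynomial ℂ) g :=
    ((Polynomial.irreducible_X).coprime_iff_not_dvd.2 hdvd).pow_left
  obtain ⟨u, v, huv⟩ := hcop
  set e := Polynomial.aeval M (u * Polynomial.X ^ (a + 1)) with he
  set f := Polynomial.aeval M (v * g) with hf
  have hef : e + f = 1 := by rw [he, hf, ← map_add, huv, map_one]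
  have hmul : e * f = 0 := by
    rw [he, hf, ← map_mul, show u * Polynomial.X ^ (a + 1) * (v * g)
      = (u * v * Polynomial.X) * (Polynomial.X ^ a * g) by ring, ← hg, map_mul,
      Matrix.aeval_self_charpoly, mul_zero]
  have hidem : IsIdempotentElem e := by
    have : e * (e + f) = e := by rw [hef, mul_one]
    rwa [mul_add, hmul, add_zero] at this
  have htr : e.trace = 0 := tr0 _ (by simp [pow_succ, ← mul_assoc])
  have he0 : e = 0 := by
    have h1 : IsIdempotentElem (Matrix.toLin' e) := by
      rw [IsIdempotentElem, Module.End.mul_eq_comp, ← Matrix.toLin'_mul, hidem.eq]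
    have := (LinearMap.IsIdempotentElem.trace_eq_zero_iff h1).1 (by rw [Matrix.trace_toLin'_eq, htr])
    simpa using this
  refine ⟨a, ?_⟩
  have : M ^ a * f = M ^ a := by rw [he0, zero_add] at hef; rw [hef, mul_one]
  rw [← this, hf, ← Polynomial.aeval_X_pow (R := ℂ) M, ← map_mul, show
    Polynomial.X ^ a * (v * g) = v * (Polynomial.X ^ a * g) by ring, ← hg, map_mul,
      Matrix.aeval_self_charpoly, mul_zero]

/-! ### Burnside's theorem and the span of nonempty words. -/

section Burnside
variable {V : Type*} [AddCommGroup V] [Module ℂ V] [FiniteDimensional ℂ V]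

/-- Over `ℂ` the endomorphisms of a simple module are scalars, so every linear `g` commutes with
them; by Jacobson density `g` agrees on a basis with an element of `R`. -/
theorem Subalgebra.eq_top_of_isSimpleModule (R : Subalgebra ℂ (Module.End ℂ V))
    [IsSimpleModule R V] : R = ⊤ := by
  rw [eq_top_iff]
  classical
  intro g _
  let b := Module.finBasis ℂ V
  let f : Module.End (Module.End R V) V :=
    { toFun := g
      map_add' := map_add g
      map_smul' := by
        intro x v
        obtain ⟨c, rfl⟩ := (IsSimpleModule.algebraMap_end_bijective_of_isAlgClosed ℂ
          (A := R) (V := V)).2 x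
        simp }
  obtain ⟨r, hr⟩ := jacobson_density f (Finset.univ.image b)
  have : g = r.1 := by
    refine b.ext fun i => ?_
    exact hr (b i) (by simp)
  rw [this]; exact r.2

end Burnside

/-- The product of the matrices of a family along a list of letters. -/
def wprod {S b : Type*} [Fintype b] [DecidableEq b] (A : S → Matrix b b ℂ) (l : List S) :
    Matrix b b ℂ := (l.map A).prod

/-- A family of matrices, not all zero, without nontrivial common invariant subspace. -/
def IsIrredFamily {S b : Type*} [Fintype b] (A : S → Matrix b b ℂ) : Prop :=
  (∃ s, A s ≠ 0) ∧ ∀ p : Submodule ℂ (b → ℂ), (∀ s, ∀ v ∈ p, A s *ᵥ v ∈ p) → p = ⊥ ∨ p = ⊤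

section wprod
variable {S b : Type*} [Fintype b] [DecidableEq b] (A : S → Matrix b b ℂ)

@[simp] theorem wprod_nil : wprod A [] = 1 := rfl
@[simp] theorem wprod_cons (s : S) (l : List S) : wprod A (s :: l) = A s * wprod A l := by
  simp [wprod]
theorem wprod_append (l l' : List S) : wprod A (l ++ l') = wprod A l * wprod A l' := by
  simp [wprod]
theorem wprod_singleton (s : S) : wprod A [s] = A s := by simp [wprod]
end wprod

section irred
variable {S b : Type*} [Fintype b] [DecidableEq b] {A : S → Matrix b b ℂ}

/-- Burnside yields the whole algebra only if the empty word is allowed. The span of the nonempty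
words is a two-sided ideal of that algebra containing a nonzero letter, and the matrix algebra is
simple. -/
theorem IsIrredFamily.span_wprod_eq_top (h : IsIrredFamily A) :
    Submodule.span ℂ {M | ∃ l : List S, l ≠ [] ∧ M = wprod A l} = ⊤ := by
  obtain ⟨⟨s₀, hs₀⟩, hirr⟩ := h
  have hadj : Algebra.adjoin ℂ (Set.range fun s => Matrix.toLin' (A s)) = ⊤ := by
    set R := Algebra.adjoin ℂ (Set.range fun s => Matrix.toLin' (A s))
    obtain ⟨i₀, j₀, hij⟩ : ∃ i j, A s₀ i j ≠ 0 := by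
      by_contra hcon; push Not at hcon; exact hs₀ (by ext i j; simp [hcon])
    have : Nontrivial (b → ℂ) := ⟨⟨0, Pi.single i₀ 1, fun h => by
      have := congrFun h i₀; simp at this⟩⟩
    have : IsSimpleModule R (b → ℂ) := by
      refine IsSimpleModule.mk (toIsSimpleOrder := ?_)
      refine { eq_bot_or_eq_top := fun p => ?_ }
      have := hirr (p.restrictScalars ℂ) (fun s v hv => by
        have : (⟨Matrix.toLin' (A s), Algebra.subset_adjoin ⟨s, rfl⟩⟩ : R) • v ∈ p :=
          p.smul_mem _ hv
        exact this)
      simpa using this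
    exact Subalgebra.eq_top_of_isSimpleModule R
  set U := Submodule.span ℂ {M | ∃ l : List S, l ≠ [] ∧ M = wprod A l} with hU
  have hadj' : Algebra.adjoin ℂ (Set.range A) = ⊤ := by
    have := congrArg (Subalgebra.comap (Matrix.toLinAlgEquiv' (R := ℂ) (n := b)).toAlgHom) hadj
    rw [Algebra.comap_top] at this
    rw [← this]
    have h2 : (Set.range fun s => Matrix.toLin' (A s)) =
        (Matrix.toLinAlgEquiv' (R := ℂ) (n := b)).toAlgHom '' Set.range A := by
      rw [← Set.range_comp]; rfl
    rw [h2, ← AlgHom.map_adjoin, Subalgebra.comap_map_eq_self_of_injective]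
    exact (Matrix.toLinAlgEquiv' (R := ℂ) (n := b)).injective
  have hl : ∀ X : Matrix b b ℂ, ∀ M ∈ U, X * M ∈ U := by
    intro X M hM
    have hX : X ∈ Algebra.adjoin ℂ (Set.range A) := by rw [hadj']; trivial
    induction hX using Algebra.adjoin_induction generalizing M with
    | mem x hx =>
      obtain ⟨s, rfl⟩ := hx
      induction hM using Submodule.span_induction with
      | mem y hy =>
        obtain ⟨l, _, rfl⟩ := hy
        exact Submodule.subset_span ⟨s :: l, by simp, by simp⟩
      | zero => simp
      | add x y _ _ h1 h2 => rw [mul_add]; exact U.add_mem h1 h2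
      | smul c x _ h1 => rw [Matrix.mul_smul]; exact U.smul_mem c h1
    | algebraMap r => rw [← Algebra.smul_def]; exact U.smul_mem _ hM
    | add x y _ _ h1 h2 => rw [add_mul]; exact U.add_mem (h1 M hM) (h2 M hM)
    | mul x y _ _ h1 h2 => rw [mul_assoc]; exact h1 _ (h2 _ hM)
  have hr : ∀ X : Matrix b b ℂ, ∀ M ∈ U, M * X ∈ U := by
    intro X M hM
    have hX : X ∈ Algebra.adjoin ℂ (Set.range A) := by rw [hadj']; trivial
    induction hX using Algebra.adjoin_induction generalizing M with
    | mem x hx =>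
      obtain ⟨s, rfl⟩ := hx
      induction hM using Submodule.span_induction with
      | mem y hy =>
        obtain ⟨l, _, rfl⟩ := hy
        exact Submodule.subset_span ⟨l ++ [s], by simp, by simp [wprod_append]⟩
      | zero => simp
      | add x y _ _ h1 h2 => rw [add_mul]; exact U.add_mem h1 h2
      | smul c x _ h1 => rw [Matrix.smul_mul]; exact U.smul_mem c h1
    | algebraMap r =>
      rw [← Algebra.commutes, ← Algebra.smul_def]; exact U.smul_mem _ hM
    | add x y _ _ h1 h2 => rw [mul_add]; exact U.add_mem (h1 M hM) (h2 M hM)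
    | mul x y _ _ h1 h2 => rw [← mul_assoc]; exact h2 _ (h1 _ hM)
  obtain ⟨i₀, j₀, hij⟩ : ∃ i j, A s₀ i j ≠ 0 := by
    by_contra hcon; push Not at hcon; exact hs₀ (by ext i j; simp [hcon])
  have hA : A s₀ ∈ U := Submodule.subset_span ⟨[s₀], by simp, by simp⟩
  rw [eq_top_iff]
  intro M _
  rw [Matrix.matrix_eq_sum_single M]
  refine U.sum_mem fun i _ => U.sum_mem fun j _ => ?_
  have := hr (Matrix.single j₀ j (M i j)) _ (hl (Matrix.single i i₀ (A s₀ i₀ j₀)⁻¹) _ hA)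
  rw [Matrix.single_mul_mul_single] at this
  simpa [hij] using this

end irred

section intertwine
variable {S b n : Type*} [Fintype b] [DecidableEq b] [Fintype n] [DecidableEq n]

theorem wprod_intertwine {A : S → Matrix b b ℂ} {B : S → Matrix n n ℂ} {Y : Matrix n b ℂ}
    (h : ∀ s, Y * A s = B s * Y) (l : List S) : Y * wprod A l = wprod B l * Y := by
  induction l with
  | nil => simp
  | cons s l ih => rw [wprod_cons, wprod_cons, ← Matrix.mul_assoc, h, Matrix.mul_assoc, ih,
      Matrix.mul_assoc]
end intertwine

/-! ### Representations of the free algebra whose total trace is a multiple of a character. -/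

/-- The representation of the free algebra given by a family of matrices. -/
noncomputable def freeRep {S b : Type*} [Fintype b] [DecidableEq b] (A : S → Matrix b b ℂ) :
    MonoidAlgebra ℂ (FreeMonoid S) →ₐ[ℂ] Matrix b b ℂ :=
  MonoidAlgebra.lift ℂ _ _ (FreeMonoid.lift A)

theorem freeRep_single {S b : Type*} [Fintype b] [DecidableEq b] (A : S → Matrix b b ℂ)
    (l : FreeMonoid S) : freeRep A (MonoidAlgebra.single l 1) = wprod A (FreeMonoid.toList l) := by
  simp [freeRep, FreeMonoid.lift_apply, wprod]

/-- The character of the free algebra given by a weight on letters. -/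
noncomputable def freeChar {S : Type*} (φ : S → ℂ) : MonoidAlgebra ℂ (FreeMonoid S) →ₐ[ℂ] ℂ :=
  MonoidAlgebra.lift ℂ _ _ (FreeMonoid.lift φ)

theorem freeChar_single {S : Type*} (φ : S → ℂ) (l : FreeMonoid S) :
    freeChar φ (MonoidAlgebra.single l 1) = ((FreeMonoid.toList l).map φ).prod := by
  simp [freeChar, FreeMonoid.lift_apply]

section principle
variable {S ι : Type*} [Fintype ι] [DecidableEq ι] {n : ι → Type*} [∀ k, Fintype (n k)]
  [∀ k, DecidableEq (n k)] {T : (k : ι) → S → Matrix (n k) (n k) ℂ} {φ : S → ℂ} {c : ℂ}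

-- `freeChar 0` reads off the coefficient of the empty word, the only word on which the trace
-- hypothesis is silent; its term corrects the value there to the total dimension.
omit [DecidableEq ι] in
theorem sum_trace_freeRep
    (h : ∀ l : List S, l ≠ [] → ∑ k, (wprod (T k) l).trace = c * (l.map φ).prod)
    (f : MonoidAlgebra ℂ (FreeMonoid S)) :
    ∑ k, (freeRep (T k) f).trace =
      c * freeChar φ f + ((∑ k, (Fintype.card (n k) : ℂ)) - c) * freeChar 0 f := by
  induction f using MonoidAlgebra.induction_linear with
  | zero => simp
  | add f g hf hg => simp only [map_add, Matrix.trace_add, Finset.sum_add_distrib, hf, hg]; ring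
  | single l r =>
    have : MonoidAlgebra.single l r = r • MonoidAlgebra.single l (1 : ℂ) := by simp
    rw [this]
    simp only [map_smul, Matrix.trace_smul, smul_eq_mul, freeRep_single, freeChar_single,
      ← Finset.mul_sum]
    by_cases hl : FreeMonoid.toList l = []
    · simp [hl, Matrix.trace_one]; ring
    · rw [h _ hl]
      obtain ⟨s, l', hs⟩ := List.exists_cons_of_ne_nil hl
      simp [hs]; ring

/-- Both characters are multiplicative, so they also kill all positive powers of `f`. The direct sum
of the representations of `f` thus has traceless powers and is nilpotent, and so is each block. -/
theorem isNilpotent_freeRep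
    (h : ∀ l : List S, l ≠ [] → ∑ k, (wprod (T k) l).trace = c * (l.map φ).prod)
    {f : MonoidAlgebra ℂ (FreeMonoid S)} (hf : freeChar φ f = 0) (hf0 : freeChar 0 f = 0) (k : ι) :
    IsNilpotent (freeRep (T k) f) := by
  have : IsNilpotent (Matrix.blockDiagonal' fun k => freeRep (T k) f) := by
    apply Matrix.isNilpotent_of_trace_pow_eq_zero
    intro m hm
    rw [← Matrix.blockDiagonal'_pow, Matrix.trace_blockDiagonal']
    have := sum_trace_freeRep h (f ^ m)
    simp only [map_pow, hf, hf0, zero_pow (by omega : m ≠ 0)] at this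
    simpa using this
  obtain ⟨m, hm⟩ := this
  refine ⟨m, ?_⟩
  rw [← Matrix.blockDiagonal'_pow, ← Matrix.blockDiagonal'_zero, Matrix.blockDiagonal'_inj] at hm
  exact congrFun hm k

variable [Fintype S] (w : S → ℂ)

/-- The identity for the sum over `k` splits into one for each `k`: a word minus `φ(word)` times the
weighted average of the letters is killed by both characters, hence nilpotent and traceless in every
block. -/
theorem trace_wprod_eq (hw : ∑ s, w s * φ s = 1)
    (h : ∀ l : List S, l ≠ [] → ∑ k, (wprod (T k) l).trace = c * (l.map φ).prod) (k : ι)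
    (l : List S) (hl : l ≠ []) :
    (wprod (T k) l).trace = (l.map φ).prod * (∑ s, w s • T k s).trace := by
  let x : MonoidAlgebra ℂ (FreeMonoid S) := ∑ s, w s • MonoidAlgebra.single (FreeMonoid.of s) 1
  let f := MonoidAlgebra.single (FreeMonoid.ofList l) 1 - (l.map φ).prod • x
  obtain ⟨s, l', rfl⟩ := List.exists_cons_of_ne_nil hl
  have hx : freeChar φ x = 1 := by
    simp only [x, map_sum, map_smul, freeChar_single]; simpa using hw
  have hx0 : freeChar 0 x = 0 := by
    simp only [x, map_sum, map_smul, freeChar_single]; simp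
  have hxT : freeRep (T k) x = ∑ s, w s • T k s := by
    simp only [x, map_sum, map_smul, freeRep_single]; simp
  have := isNilpotent_freeRep h (f := f) (by
    simp only [f, map_sub, map_smul, hx, freeChar_single]; simp) (by
    simp only [f, map_sub, map_smul, hx0, freeChar_single]; simp) k
  have := (Matrix.isNilpotent_trace_of_isNilpotent this).eq_zero
  simp only [f, map_sub, map_smul, hxT, freeRep_single, Matrix.trace_sub, Matrix.trace_smul,
    sub_eq_zero] at this
  simpa using this

/-- The same principle for `x ^ m - x`, where `x` is the weighted average: `φ x = 1`, and `1 ≤ m`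
excludes a constant term. -/
theorem average_spectrum (hw : ∑ s, w s * φ s = 1)
    (h : ∀ l : List S, l ≠ [] → ∑ k, (wprod (T k) l).trace = c * (l.map φ).prod) (k : ι) :
    IsNilpotent ((∑ s, w s • T k s) ^ 2 - ∑ s, w s • T k s) ∧
    ∀ m, 1 ≤ m → ((∑ s, w s • T k s) ^ m).trace = (∑ s, w s • T k s).trace := by
  let x : MonoidAlgebra ℂ (FreeMonoid S) := ∑ s, w s • MonoidAlgebra.single (FreeMonoid.of s) 1
  have hx : freeChar φ x = 1 := by
    simp only [x, map_sum, map_smul, freeChar_single]; simpa using hw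
  have hx0 : freeChar 0 x = 0 := by
    simp only [x, map_sum, map_smul, freeChar_single]; simp
  have hxT : freeRep (T k) x = ∑ s, w s • T k s := by
    simp only [x, map_sum, map_smul, freeRep_single]; simp
  have key : ∀ m, 1 ≤ m → IsNilpotent ((∑ s, w s • T k s) ^ m - ∑ s, w s • T k s) := by
    intro m hm
    have := isNilpotent_freeRep h (f := x ^ m - x) (by simp [hx])
      (by simp [hx0, show m ≠ 0 by omega]) k
    simpa [hxT] using this
  refine ⟨key 2 (by norm_num), fun m hm => ?_⟩
  have := (Matrix.isNilpotent_trace_of_isNilpotent (key m hm)).eq_zero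
  rwa [Matrix.trace_sub, sub_eq_zero] at this

end principle

/-- If all nonempty words in a family of matrices are traceless, then all long words vanish. -/
theorem exists_wprod_eq_zero {S b : Type*} [Fintype b] [DecidableEq b] (T : S → Matrix b b ℂ)
    (h : ∀ l : List S, l ≠ [] → (wprod T l).trace = 0) :
    ∃ q : ℕ, ∀ l : List S, q ≤ l.length → wprod T l = 0 := by
  -- The image algebra is finite-dimensional, hence has nilpotent Jacobson radical; it suffices that
  -- every letter lies in the radical.
  let R := (freeRep T).range
  let ψ : MonoidAlgebra ℂ (FreeMonoid S) →ₐ[ℂ] R := (freeRep T).rangeRestrict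
  have hψ : ∀ f, (ψ f : Matrix b b ℂ) = freeRep T f := fun f => rfl
  have hart : IsArtinianRing R := IsArtinianRing.of_finite ℂ R
  obtain ⟨q, hq⟩ := IsArtinianRing.isNilpotent_jacobson_bot (R := R)
  let L : S → R := fun s => ψ (MonoidAlgebra.single (FreeMonoid.of s) 1)
  have hL : ∀ s, (L s : Matrix b b ℂ) = T s := fun s => by
    simp [L, hψ, freeRep_single]
  have hmem : ∀ s, L s ∈ Ideal.jacobson (⊥ : Ideal R) := by
    intro s
    rw [Ideal.mem_jacobson_iff]
    intro y
    obtain ⟨f, rfl⟩ := (freeRep T).rangeRestrict_surjective y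
    -- The nilpotency principle with `c = 0` and `φ = 0`: any multiple of a letter has no constant
    -- term.
    have hnil : IsNilpotent (ψ f * L s) := by
      have : IsNilpotent (freeRep T (f * MonoidAlgebra.single (FreeMonoid.of s) 1)) :=
        isNilpotent_freeRep (ι := Unit) (T := fun _ => T) (c := 0) (φ := 0)
          (by simpa using h) (by simp [freeChar_single]) (by simp [freeChar_single]) ()
      obtain ⟨m, hm⟩ := this
      refine ⟨m, Subtype.ext ?_⟩
      simpa [hψ, L] using hm
    obtain ⟨u, hu⟩ := hnil.isUnit_add_one
    refine ⟨(u⁻¹ : Rˣ), ?_⟩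
    rw [Ideal.mem_bot, mul_assoc]
    change (u⁻¹ : Rˣ) * (ψ f * L s) + ((u⁻¹ : Rˣ) : R) - 1 = 0
    have : ((u⁻¹ : Rˣ) : R) * (ψ f * L s + 1) = 1 := by rw [← hu]; simp
    rw [mul_add, mul_one] at this
    rw [this, sub_self]
  refine ⟨q, fun l hl => ?_⟩
  have hprod : ∀ l : List S, (l.map L).prod ∈ Ideal.jacobson (⊥ : Ideal R) ^ l.length := by
    intro l
    induction l using List.reverseRecOn with
    | nil =>
      rw [List.length_nil, Submodule.pow_zero, Ideal.one_eq_top]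
      trivial
    | append_singleton l s ih =>
      rw [List.map_append, List.prod_append, List.length_append, List.length_singleton,
        Submodule.pow_succ, List.map_singleton, List.prod_singleton]
      exact Ideal.mul_mem_mul ih (hmem s)
  have := hprod (l.take q)
  rw [List.length_take_of_le hl, hq] at this
  have h0 : ((l.take q).map L).prod = 0 := this
  have := congrArg (R.val) h0
  rw [map_list_prod, List.map_map, map_zero] at this
  rw [← List.take_append_drop q l, wprod_append, wprod, wprod]
  have hT : T = R.val ∘ L := funext fun s => (hL s).symm
  rw [hT, this, zero_mul]

/-! ### Stationary powers of power-bounded matrices. -/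

/-- A power bounded matrix with spectrum in `{0, 1}` has an idempotent power. -/
theorem Matrix.exists_pow_succ_eq_of_bounded {n : Type*} [Fintype n] [DecidableEq n]
    {E : Matrix n n ℂ} (hE : IsNilpotent (E ^ 2 - E)) (C : ℝ)
    (hC : ∀ m i j, 1 ≤ m → ‖(E ^ m) i j‖ ≤ C) : ∃ a, 1 ≤ a ∧ ∀ m, a ≤ m → E ^ m = E ^ a := by
  obtain ⟨a, ha⟩ := hE
  have hcomm : (E ^ 2 - E) = E * (E - 1) := by noncomm_ring
  rw [hcomm, (show Commute E (E - 1) from (Commute.refl E).sub_right (Commute.one_right E)).mul_pow]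
    at ha
  -- A nontrivial Jordan block at the eigenvalue `1` would make `N * E ^ m = N + m • M` grow
  -- linearly, against the bound; so the exponent of `E - 1` can be lowered one at a time.
  have step : ∀ k, E ^ a * (E - 1) ^ (k + 2) = 0 → E ^ a * (E - 1) ^ (k + 1) = 0 := by
    intro k hk
    set M := E ^ a * (E - 1) ^ (k + 1) with hM
    set N := E ^ a * (E - 1) ^ k with hN
    have hNM : N * E = N + M := by rw [hM, pow_succ, ← mul_assoc, ← hN, mul_sub, mul_one]; abel
    have hMM : M * E = M := by
      have : M * (E - 1) = 0 := by rw [← hk, hM, mul_assoc, ← pow_succ]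
      rw [mul_sub, mul_one, sub_eq_zero] at this; exact this
    have hpow : ∀ m : ℕ, N * E ^ m = N + (m : ℂ) • M := by
      intro m
      induction m with
      | zero => simp
      | succ m ih =>
        rw [pow_succ, ← mul_assoc, ih, add_mul, hNM, Matrix.smul_mul, hMM]
        push_cast; rw [add_smul, one_smul]; abel
    ext i j
    by_contra hne
    have hpos : 0 < ‖M i j‖ := norm_pos_iff.2 hne
    set K := (∑ k, ‖N i k‖) * C + ‖N i j‖ with hK
    obtain ⟨m, hm⟩ := exists_nat_gt (K / ‖M i j‖)
    have hm' : K < (m + 1 : ℕ) * ‖M i j‖ := by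
      rw [div_lt_iff₀ hpos] at hm
      refine hm.trans_le (mul_le_mul_of_nonneg_right (by push_cast; linarith) hpos.le)
    have h1 := congrFun (congrFun (hpow (m + 1)) i) j
    have h2 : ((m + 1 : ℕ) : ℂ) * M i j = (N * E ^ (m + 1)) i j - N i j := by
      rw [h1]; simp
    have h3 : ‖(N * E ^ (m + 1)) i j‖ ≤ (∑ k, ‖N i k‖) * C := by
      rw [Matrix.mul_apply, Finset.sum_mul]
      refine (norm_sum_le _ _).trans (Finset.sum_le_sum fun k _ => ?_)
      rw [norm_mul]
      exact mul_le_mul_of_nonneg_left (hC _ _ _ (by omega)) (norm_nonneg _)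
    have h4 := congrArg norm h2
    rw [norm_mul, Complex.norm_natCast] at h4
    have := norm_sub_le ((N * E ^ (m + 1)) i j) (N i j)
    linarith
  have all : ∀ k, E ^ a * (E - 1) ^ (k + 1) = 0 → E ^ a * (E - 1) = 0 := by
    intro k
    induction k with
    | zero => simp
    | succ k ih => exact fun h => ih (step k h)
  have h1 : E ^ a * (E - 1) = 0 := all a (by rw [pow_succ, ← mul_assoc, ha, zero_mul])
  rw [mul_sub, mul_one, ← pow_succ, sub_eq_zero] at h1
  have h2 : ∀ m, E ^ (a + m) = E ^ a := by
    intro m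
    induction m with
    | zero => simp
    | succ m ih => rw [← add_assoc, pow_succ, ih, ← pow_succ, h1]
  refine ⟨a + 1, by omega, fun m hm => ?_⟩
  rw [h1, ← h2 (m - a)]; congr 1; omega

/-! ### Kraus maps, their matrices, and their powers as sums over words. -/

theorem sum_prod_ofFn {R O : Type*} [Semiring R] [Fintype O] {q : ℕ} (F : Fin q → O → R) :
    ∑ o : Fin q → O, (List.ofFn fun s => F s (o s)).prod = (List.ofFn fun s => ∑ x, F s x).prod := by
  induction q with
  | zero => simp
  | succ q ih =>
    rw [← (Fin.consEquiv fun _ => O).sum_comp, Fintype.sum_prod_type, List.ofFn_succ, List.prod_cons,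
      ← ih fun s => F s.succ, Finset.sum_mul_sum]
    simp [Fin.consEquiv, List.ofFn_succ]

theorem map_star_mul {l m n : Type*} [Fintype m] (A : Matrix l m ℂ) (B : Matrix m n ℂ) :
    (A * B).map star = A.map star * B.map star := by
  ext i j; simp [Matrix.mul_apply]

theorem kronecker_prod_ofFn {b n : Type*} [Fintype b] [DecidableEq b] [Fintype n] [DecidableEq n]
    {q : ℕ} (F : Fin q → Matrix b b ℂ) (G : Fin q → Matrix n n ℂ) :
    ((List.ofFn F).prod.map star) ⊗ₖ (List.ofFn G).prod =
      (List.ofFn fun s => (F s).map star ⊗ₖ G s).prod := by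
  induction q with
  | zero => simp [Matrix.map_one]
  | succ q ih =>
    rw [List.ofFn_succ, List.ofFn_succ, List.ofFn_succ, List.prod_cons, List.prod_cons,
      List.prod_cons, map_star_mul, Matrix.mul_kronecker_mul, ih]

/-- The family of all words of length `q` of a family of matrices. -/
def wordFamily {S b : Type*} [Fintype b] [DecidableEq b] (A : S → Matrix b b ℂ) (q : ℕ) :
    (Fin q → S) → Matrix b b ℂ := fun w => wprod A (List.ofFn w)

/-- The completely positive (if `A = B`) map with Kraus family `√κ • A`. -/
noncomputable def krausMap {S b n : Type*} [Fintype S] [Fintype b] [Fintype n] (κ : ℝ)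
    (A : S → Matrix b b ℂ) (B : S → Matrix n n ℂ) (X : Matrix n b ℂ) : Matrix n b ℂ :=
  (κ : ℂ) • ∑ s, B s * X * (A s)ᴴ

/-- The matrix of `krausMap` on vectorized matrices. -/
noncomputable def krausMatrix {S b n : Type*} [Fintype S] (κ : ℝ)
    (A : S → Matrix b b ℂ) (B : S → Matrix n n ℂ) : Matrix (b × n) (b × n) ℂ :=
  (κ : ℂ) • ∑ s, (A s).map star ⊗ₖ B s

section kraus
variable {S b n : Type*} [Fintype S] [Fintype b] [Fintype n] {κ : ℝ}
  {A : S → Matrix b b ℂ} {B : S → Matrix n n ℂ}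

theorem krausMatrix_mulVec_vec (X : Matrix n b ℂ) :
    krausMatrix κ A B *ᵥ X.vec = (krausMap κ A B X).vec := by
  simp only [krausMatrix, krausMap, Matrix.smul_mulVec, Matrix.sum_mulVec,
    Matrix.kronecker_mulVec_vec, Matrix.vec_smul, Matrix.vec_sum]
  rfl

omit [Fintype b] [Fintype n] in
theorem krausMatrix_conjTranspose :
    (krausMatrix κ A B)ᴴ = krausMatrix κ (fun s => (A s)ᴴ) (fun s => (B s)ᴴ) := by
  simp only [krausMatrix, Matrix.conjTranspose_smul, Matrix.conjTranspose_sum,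
    Matrix.conjTranspose_kronecker]
  simp
  rfl

theorem krausMap_conjTranspose (X : Matrix n b ℂ) :
    (krausMap κ A B X)ᴴ = krausMap κ B A Xᴴ := by
  simp [krausMap, Matrix.conjTranspose_sum, Matrix.mul_assoc]

/-- Duality of the Kraus map with respect to the trace pairing. -/
theorem trace_krausMap_adjoint (Y : Matrix b n ℂ) (X : Matrix n b ℂ) :
    (krausMap κ (fun s => (B s)ᴴ) (fun s => (A s)ᴴ) Y * X).trace =
      (Y * krausMap κ A B X).trace := by
  simp only [krausMap, Matrix.smul_mul, Matrix.mul_smul, Matrix.sum_mul, Matrix.mul_sum,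
    Matrix.trace_smul, Matrix.trace_sum, Matrix.conjTranspose_conjTranspose]
  congr 1
  refine Finset.sum_congr rfl fun s _ => ?_
  rw [Matrix.mul_assoc, Matrix.mul_assoc, Matrix.trace_mul_comm]
  simp only [Matrix.mul_assoc]

variable [DecidableEq b] [DecidableEq n]

theorem krausMatrix_pow (q : ℕ) :
    krausMatrix κ A B ^ q = krausMatrix (κ ^ q) (wordFamily A q) (wordFamily B q) := by
  have : ∀ M : Matrix (b × n) (b × n) ℂ, M ^ q = (List.ofFn fun _ : Fin q => M).prod := by
    intro M; simp [List.ofFn_const]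
  rw [krausMatrix, smul_pow, this, ← sum_prod_ofFn, krausMatrix]
  push_cast
  congr 1
  refine Finset.sum_congr rfl fun w _ => ?_
  rw [← kronecker_prod_ofFn, wordFamily, wordFamily, wprod, wprod, List.map_ofFn, List.map_ofFn]
  rfl

-- Since `tr(X̄ ⊗ X) = |tr X|²`, traces against transfer matrices become sums of squares. This
-- positivity is what later turns constant traces into bounds.
omit [DecidableEq b] in
theorem trace_krausMatrix_mul (X : Matrix b b ℂ) :
    (krausMatrix κ A A * (X.map star ⊗ₖ X)).trace = ((κ * ∑ s, ‖(A s * X).trace‖ ^ 2 : ℝ) : ℂ) := by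
  simp only [krausMatrix, Matrix.smul_mul, Matrix.sum_mul, Matrix.trace_smul, Matrix.trace_sum,
    ← Matrix.mul_kronecker_mul, Matrix.trace_kronecker]
  push_cast
  rw [smul_eq_mul]
  congr 1
  refine Finset.sum_congr rfl fun s _ => ?_
  rw [← Complex.conj_mul']
  congr 1
  rw [← map_star_mul]
  simp [Matrix.trace, Matrix.mul_apply]

end kraus

/-! ### Full families and Schur's lemma. -/

/-- The nonempty words of the family span the full matrix algebra. -/
def IsFullFamily {S b : Type*} [Fintype b] [DecidableEq b] (A : S → Matrix b b ℂ) : Prop :=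
  Submodule.span ℂ {M | ∃ l : List S, l ≠ [] ∧ M = wprod A l} = ⊤

namespace IsFullFamily
variable {S b n : Type*} [Fintype b] [DecidableEq b] [Fintype n] [DecidableEq n]
  {A : S → Matrix b b ℂ} {B : S → Matrix n n ℂ}

theorem induction (hA : IsFullFamily A) {p : Matrix b b ℂ → Prop}
    (hw : ∀ l : List S, l ≠ [] → p (wprod A l)) (h0 : p 0)
    (hadd : ∀ X Y, p X → p Y → p (X + Y)) (hsmul : ∀ (c : ℂ) X, p X → p (c • X))
    (X : Matrix b b ℂ) : p X := by
  have hX : X ∈ Submodule.span ℂ {M | ∃ l : List S, l ≠ [] ∧ M = wprod A l} := by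
    rw [hA]; trivial
  induction hX using Submodule.span_induction with
  | mem x hx => obtain ⟨l, hl, rfl⟩ := hx; exact hw l hl
  | zero => exact h0
  | add x y _ _ hx hy => exact hadd _ _ hx hy
  | smul c x _ hx => exact hsmul _ _ hx

theorem conjTranspose (hA : IsFullFamily A) : IsFullFamily fun s => (A s)ᴴ := by
  have hw : ∀ l : List S, wprod (fun s => (A s)ᴴ) l = (wprod A l.reverse)ᴴ := by
    intro l
    induction l with
    | nil => simp
    | cons s l ih => simp [wprod_append, ih]
  have key : ∀ X : Matrix b b ℂ, Xᴴ ∈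
      Submodule.span ℂ {M | ∃ l : List S, l ≠ [] ∧ M = wprod (fun s => (A s)ᴴ) l} := by
    refine hA.induction (fun l hl => ?_) (by simp) (fun X Y hX hY => ?_) (fun c X hX => ?_)
    · exact Submodule.subset_span ⟨l.reverse, by simpa using hl, by rw [hw, List.reverse_reverse]⟩
    · rw [Matrix.conjTranspose_add]; exact Submodule.add_mem _ hX hY
    · rw [Matrix.conjTranspose_smul]; exact Submodule.smul_mem _ _ hX
  rw [IsFullFamily, eq_top_iff]
  intro X _
  simpa using key Xᴴ

/-- For any word `l`, the first `a` letters of `l ++ l₀` already annihilate `Z`. By fullness `Z * X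
* wprod A l₀ = 0` for every `X`, and matrix units `X` isolate the entries of `Z`. -/
theorem eq_zero_of_mul_wprod (hA : IsFullFamily A) {a : ℕ} (hne : ∃ l, l.length = a ∧ wprod A l ≠ 0)
    {m : Type*} {Z : Matrix m b ℂ} (hZ : ∀ l : List S, l.length = a → Z * wprod A l = 0) : Z = 0 := by
  obtain ⟨l₀, hl₀, hne⟩ := hne
  have key : ∀ X : Matrix b b ℂ, Z * X * wprod A l₀ = 0 := by
    refine hA.induction (fun l _ => ?_) (by simp) (fun X Y hX hY => ?_) (fun c X hX => ?_)
    · rw [Matrix.mul_assoc, ← wprod_append, ← List.take_append_drop a (l ++ l₀), wprod_append,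
        ← Matrix.mul_assoc, hZ _ (by simp [hl₀]), Matrix.zero_mul]
    · rw [Matrix.mul_add, Matrix.add_mul, hX, hY, add_zero]
    · rw [Matrix.mul_smul, Matrix.smul_mul, hX, smul_zero]
  obtain ⟨i, j, hij⟩ : ∃ i j, wprod A l₀ i j ≠ 0 := by
    by_contra hcon; push Not at hcon; exact hne (by ext i j; simp [hcon])
  ext r k
  have := congrFun (congrFun (key (Matrix.single k i 1)) r) j
  rw [Matrix.mul_assoc, Matrix.mul_apply, Finset.sum_eq_single k] at this
  · simpa [hij] using this
  · intro k' _ hk'; simp [hk']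
  · simp

/-- **Schur's lemma** for intertwiners between two full families. -/
theorem exists_inverse_of_intertwine (hA : IsFullFamily A) (hB : IsFullFamily B)
    {Y : Matrix n b ℂ} (hY : Y ≠ 0) (h : ∀ s, Y * A s = B s * Y) :
    ∃ Y' : Matrix b n ℂ, Y' * Y = 1 ∧ Y * Y' = 1 := by
  obtain ⟨i₀, j₀, hij⟩ : ∃ i j, Y i j ≠ 0 := by
    by_contra hcon; push Not at hcon; exact hY (by ext i j; simp [hcon])
  -- The kernel of `Y` is stable under the `A s`, hence under all matrices; one nonzero entry of `Y`
  -- then forces it to be zero. The right inverse comes dually from the left kernel and `B`.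
  have hL : ∃ L : Matrix b n ℂ, L * Y = 1 := by
    have hker : LinearMap.ker (Matrix.toLin' Y) = ⊥ := by
      rw [LinearMap.ker_eq_bot']
      intro x hx
      rw [Matrix.toLin'_apply] at hx
      have key : ∀ X : Matrix b b ℂ, Y *ᵥ (X *ᵥ x) = 0 := by
        refine hA.induction (fun l _ => ?_) (by simp) (fun X Z hX hZ => ?_) (fun c X hX => ?_)
        · rw [Matrix.mulVec_mulVec, wprod_intertwine h, ← Matrix.mulVec_mulVec, hx,
            Matrix.mulVec_zero]
        · rw [Matrix.add_mulVec, Matrix.mulVec_add, hX, hZ, add_zero]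
        · rw [Matrix.smul_mulVec, Matrix.mulVec_smul, hX, smul_zero]
      ext k
      have := congrFun (key (Matrix.single j₀ k 1)) i₀
      rw [Matrix.mulVec_mulVec, Matrix.mulVec, dotProduct, Finset.sum_eq_single k] at this
      · simpa [hij] using this
      · intro k' _ hk'; rw [Matrix.mul_single_apply_of_ne _ _ _ _ _ hk', zero_mul]
      · simp
    obtain ⟨g, hg⟩ := LinearMap.exists_leftInverse_of_injective _ hker
    refine ⟨LinearMap.toMatrix' g, ?_⟩
    rw [← LinearMap.toMatrix'_toLin' Y, ← LinearMap.toMatrix'_comp, hg, LinearMap.toMatrix'_id]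
  have hR : ∃ R : Matrix b n ℂ, Y * R = 1 := by
    have hker : LinearMap.ker (Matrix.toLin' Yᵀ) = ⊥ := by
      rw [LinearMap.ker_eq_bot']
      intro x hx
      rw [Matrix.toLin'_apply, Matrix.mulVec_transpose] at hx
      have key : ∀ X : Matrix n n ℂ, (x ᵥ* X) ᵥ* Y = 0 := by
        refine hB.induction (fun l _ => ?_) (by simp) (fun X Z hX hZ => ?_) (fun c X hX => ?_)
        · rw [Matrix.vecMul_vecMul, ← wprod_intertwine h, ← Matrix.vecMul_vecMul, hx,
            Matrix.zero_vecMul]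
        · rw [Matrix.vecMul_add, Matrix.add_vecMul, hX, hZ, add_zero]
        · rw [Matrix.vecMul_smul, Matrix.smul_vecMul, hX, smul_zero]
      ext k
      have := congrFun (key (Matrix.single k i₀ 1)) j₀
      rw [Matrix.vecMul_vecMul, Matrix.vecMul, dotProduct, Finset.sum_eq_single k] at this
      · simpa [hij] using this
      · intro k' _ hk'; simp [hk']
      · simp
    obtain ⟨g, hg⟩ := LinearMap.exists_leftInverse_of_injective _ hker
    refine ⟨(LinearMap.toMatrix' g)ᵀ, ?_⟩
    rw [← Matrix.transpose_inj, Matrix.transpose_mul, Matrix.transpose_transpose,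
      ← LinearMap.toMatrix'_toLin' Yᵀ, ← LinearMap.toMatrix'_comp, hg, LinearMap.toMatrix'_id,
      Matrix.transpose_one]
  obtain ⟨L, hL⟩ := hL
  obtain ⟨R, hR⟩ := hR
  have : L = R := by
    rw [← Matrix.mul_one L, ← hR, ← Matrix.mul_assoc, hL, Matrix.one_mul]
  exact ⟨L, hL, this ▸ hR⟩

theorem eq_smul_one_of_commute (hA : IsFullFamily A) {Y : Matrix b b ℂ}
    (h : ∀ s, Y * A s = A s * Y) : ∃ c : ℂ, Y = c • 1 := by
  have key : ∀ X : Matrix b b ℂ, Y * X = X * Y := by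
    refine hA.induction (fun l _ => wprod_intertwine h l) (by simp) (fun X Z hX hZ => ?_)
      (fun c X hX => ?_)
    · rw [Matrix.mul_add, Matrix.add_mul, hX, hZ]
    · rw [Matrix.mul_smul, Matrix.smul_mul, hX]
  obtain ⟨c, hc⟩ := Matrix.mem_range_scalar_of_commute_single (M := Y)
    (fun i j _ => (key (Matrix.single i j 1)).symm)
  exact ⟨c, by rw [← hc]; simp [Matrix.smul_one_eq_diagonal]⟩

end IsFullFamily

/-! ### Boundedness and stabilization of transfer matrix powers. -/

section bounded
variable {S b : Type*} [Fintype S] [Fintype b] [DecidableEq b] {κ : ℝ} {A : S → Matrix b b ℂ}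

theorem trace_krausMatrix_pow_mul (m : ℕ) (X : Matrix b b ℂ) :
    (krausMatrix κ A A ^ m * (X.map star ⊗ₖ X)).trace =
      ((κ ^ m * ∑ w, ‖(wordFamily A m w * X).trace‖ ^ 2 : ℝ) : ℂ) := by
  rw [krausMatrix_pow, trace_krausMatrix_mul]

theorem trace_krausMatrix_pow (m : ℕ) :
    (krausMatrix κ A A ^ m).trace = ((κ ^ m * ∑ w, ‖(wordFamily A m w).trace‖ ^ 2 : ℝ) : ℂ) := by
  have := trace_krausMatrix_pow_mul (κ := κ) (A := A) m 1
  simpa [Matrix.map_one] using this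

/-- In the trace of the power `m + l.length`, a sum of nonnegative terms equal to `τ`, the terms
ending in the fixed word `l` bound `κ ^ m * ∑ |tr(A_w A_l)|²` uniformly in `m`. Fullness extends the
bound from words to all matrices. -/
theorem krausMatrix_pow_bounded (hκ : 0 < κ) (hA : IsFullFamily A) {τ : ℂ}
    (htr : ∀ m, 1 ≤ m → (krausMatrix κ A A ^ m).trace = τ) :
    ∃ C : ℝ, ∀ m i j, 1 ≤ m → ‖(krausMatrix κ A A ^ m) i j‖ ≤ C := by
  have hb : ∀ X : Matrix b b ℂ, ∃ C : ℝ, ∀ m, 1 ≤ m →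
      κ ^ m * ∑ w, ‖(wordFamily A m w * X).trace‖ ^ 2 ≤ C := by
    refine hA.induction (fun l _ => ?_) ⟨0, by simp⟩ (fun X Y hX hY => ?_) (fun c X hX => ?_)
    · refine ⟨τ.re / κ ^ l.length, fun m hm => ?_⟩
      have h1 := htr (m + l.length) (by omega)
      have h0 : krausMatrix κ A A ^ l.length = ((κ ^ l.length : ℝ) : ℂ) • ∑ u,
          (wordFamily A l.length u).map star ⊗ₖ wordFamily A l.length u := krausMatrix_pow _
      rw [pow_add, h0, Matrix.mul_smul, Matrix.mul_sum, Matrix.trace_smul, Matrix.trace_sum] at h1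
      simp only [trace_krausMatrix_pow_mul] at h1
      rw [← Complex.ofReal_sum, smul_eq_mul, ← Complex.ofReal_mul] at h1
      rw [le_div_iff₀' (by positivity), ← h1, Complex.ofReal_re]
      refine mul_le_mul_of_nonneg_left ?_ (by positivity)
      have h2 : wprod A l = wordFamily A l.length l.get := by simp [wordFamily]
      rw [h2]
      exact Finset.single_le_sum (f := fun u => κ ^ m * ∑ w,
        ‖(wordFamily A m w * wordFamily A l.length u).trace‖ ^ 2)
        (fun u _ => by positivity) (Finset.mem_univ _)
    · obtain ⟨C, hC⟩ := hX
      obtain ⟨C', hC'⟩ := hY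
      refine ⟨2 * C + 2 * C', fun m hm => ?_⟩
      have : κ ^ m * ∑ w, ‖(wordFamily A m w * (X + Y)).trace‖ ^ 2 ≤
          2 * (κ ^ m * ∑ w, ‖(wordFamily A m w * X).trace‖ ^ 2) +
          2 * (κ ^ m * ∑ w, ‖(wordFamily A m w * Y).trace‖ ^ 2) := by
        rw [mul_left_comm 2, mul_left_comm 2, ← mul_add, Finset.mul_sum (a := 2),
          Finset.mul_sum (a := 2), ← Finset.sum_add_distrib]
        refine mul_le_mul_of_nonneg_left (Finset.sum_le_sum fun w _ => ?_) (by positivity)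
        rw [Matrix.mul_add, Matrix.trace_add]
        have h1 := norm_add_le (wordFamily A m w * X).trace (wordFamily A m w * Y).trace
        have h2 := pow_le_pow_left₀ (norm_nonneg _) h1 2
        nlinarith [sq_nonneg (‖(wordFamily A m w * X).trace‖ - ‖(wordFamily A m w * Y).trace‖)]
      linarith [hC m hm, hC' m hm]
    · obtain ⟨C, hC⟩ := hX
      refine ⟨‖c‖ ^ 2 * C, fun m hm => ?_⟩
      have : κ ^ m * ∑ w, ‖(wordFamily A m w * (c • X)).trace‖ ^ 2 =
          ‖c‖ ^ 2 * (κ ^ m * ∑ w, ‖(wordFamily A m w * X).trace‖ ^ 2) := by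
        rw [mul_left_comm, Finset.mul_sum (s := Finset.univ) (a := ‖c‖ ^ 2)]
        simp [Matrix.trace_smul, mul_pow]
      rw [this]
      exact mul_le_mul_of_nonneg_left (hC m hm) (by positivity)
  choose C hC using hb
  -- Testing against matrix units bounds the weighted sums of squared word entries; an entry of the
  -- power is a sum of products of two word entries, controlled by `xy ≤ x² + y²`.
  let D : b → b → ℝ := fun i j => C (Matrix.single j i 1)
  have hD : ∀ m, 1 ≤ m → ∀ i j, κ ^ m * ∑ w, ‖wordFamily A m w i j‖ ^ 2 ≤ D i j := by
    intro m hm i j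
    have := hC (Matrix.single j i 1) m hm
    simpa [Matrix.trace_mul_single] using this
  have hD0 : ∀ i j, 0 ≤ D i j := fun i j => le_trans (by positivity) (hD 1 le_rfl i j)
  refine ⟨∑ i, ∑ j, D i j + ∑ i, ∑ j, D i j, fun m i j hm => ?_⟩
  have hle : ∀ i j, D i j ≤ ∑ i, ∑ j, D i j := fun i j =>
    (Finset.single_le_sum (f := fun j => D i j) (fun j _ => hD0 i j) (Finset.mem_univ j)).trans
    (Finset.single_le_sum (f := fun i => ∑ j, D i j)
      (fun i _ => Finset.sum_nonneg fun j _ => hD0 i j) (Finset.mem_univ i))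
  refine le_trans ?_ (add_le_add (hle i.1 j.1) (hle i.2 j.2))
  refine le_trans ?_ (add_le_add (hD m hm i.1 j.1) (hD m hm i.2 j.2))
  rw [← mul_add, ← Finset.sum_add_distrib, krausMatrix_pow, krausMatrix, Matrix.smul_apply,
    norm_smul, Complex.norm_real, Real.norm_of_nonneg (by positivity : 0 ≤ κ ^ m)]
  refine mul_le_mul_of_nonneg_left ?_ (by positivity)
  rw [Matrix.sum_apply]
  refine (norm_sum_le _ _).trans (Finset.sum_le_sum fun w _ => ?_)
  rw [Matrix.kroneckerMap_apply, norm_mul, Matrix.map_apply, norm_star]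
  nlinarith [sq_nonneg (‖wordFamily A m w i.1 j.1‖ - ‖wordFamily A m w i.2 j.2‖),
    sq_nonneg (‖wordFamily A m w i.1 j.1‖), sq_nonneg (‖wordFamily A m w i.2 j.2‖)]

/-- Otherwise every nonempty word is traceless, hence every matrix is, including the identity. -/
theorem IsFullFamily.exists_trace_krausMatrix_pow_ne_zero [Nonempty b] (hκ : 0 < κ)
    (hA : IsFullFamily A) : ∃ m, 1 ≤ m ∧ (krausMatrix κ A A ^ m).trace ≠ 0 := by
  by_contra! hcon
  have key : ∀ X : Matrix b b ℂ, X.trace = 0 := by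
    refine hA.induction (fun l hl => ?_) (by simp) (fun X Y hX hY => ?_) (fun c X hX => ?_)
    · have := hcon l.length (List.length_pos_iff.2 hl)
      rw [trace_krausMatrix_pow] at this
      have h1 : ∑ w, ‖(wordFamily A l.length w).trace‖ ^ 2 = 0 := by
        have := Complex.ofReal_eq_zero.1 this
        exact (mul_eq_zero.1 this).resolve_left (by positivity)
      rw [Finset.sum_eq_zero_iff_of_nonneg fun _ _ => by positivity] at h1
      have h2 : wprod A l = wordFamily A l.length l.get := by simp [wordFamily]
      rw [h2]
      simpa using h1 l.get (Finset.mem_univ _)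
    · rw [Matrix.trace_add, hX, hY, add_zero]
    · rw [Matrix.trace_smul, hX, smul_zero]
  have := key 1
  simp [Matrix.trace_one] at this

end bounded

/-- A full family whose Kraus map has stationary powers from exponent `a` on. -/
structure IsStableFamily {S b : Type*} [Fintype S] [Fintype b] [DecidableEq b] (κ : ℝ)
    (A : S → Matrix b b ℂ) (a : ℕ) : Prop where
  pos : 0 < κ
  full : IsFullFamily A
  pow_eq : ∀ m, a ≤ m → krausMatrix κ A A ^ m = krausMatrix κ A A ^ a
  exists_wprod_ne_zero : ∃ l : List S, l.length = a ∧ wprod A l ≠ 0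

theorem IsFullFamily.exists_isStableFamily {S b : Type*} [Fintype S] [Fintype b] [DecidableEq b]
    [Nonempty b] {κ : ℝ} {A : S → Matrix b b ℂ} (hκ : 0 < κ) (hA : IsFullFamily A) {τ : ℂ}
    (hnil : IsNilpotent (krausMatrix κ A A ^ 2 - krausMatrix κ A A))
    (htr : ∀ m, 1 ≤ m → (krausMatrix κ A A ^ m).trace = τ) : ∃ a, 1 ≤ a ∧ IsStableFamily κ A a := by
  obtain ⟨C, hC⟩ := krausMatrix_pow_bounded hκ hA htr
  obtain ⟨a, ha, hpow⟩ := Matrix.exists_pow_succ_eq_of_bounded hnil C hC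
  refine ⟨a, ha, hκ, hA, hpow, ?_⟩
  -- If all words of length `a` vanished, the constant `τ` would be zero, although some positive
  -- power has nonzero trace.
  by_contra! hcon
  obtain ⟨m, hm, hne⟩ := hA.exists_trace_krausMatrix_pow_ne_zero hκ
  apply hne
  rw [htr m hm, ← htr a ha, trace_krausMatrix_pow]
  simp [wordFamily, hcon _ (List.length_ofFn)]

namespace IsStableFamily
variable {S b n : Type*} [Fintype S] [Fintype b] [DecidableEq b] [Fintype n] [DecidableEq n]
  {κ : ℝ} {A : S → Matrix b b ℂ} {B : S → Matrix n n ℂ} {a a' : ℕ}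

theorem conjTranspose (h : IsStableFamily κ A a) : IsStableFamily κ (fun s => (A s)ᴴ) a where
  pos := h.pos
  full := h.full.conjTranspose
  pow_eq m hm := by
    rw [← krausMatrix_conjTranspose, ← Matrix.conjTranspose_pow, h.pow_eq m hm,
      Matrix.conjTranspose_pow]
  exists_wprod_ne_zero := by
    obtain ⟨l, hl, hne⟩ := h.exists_wprod_ne_zero
    refine ⟨l.reverse, by simpa using hl, fun h0 => hne ?_⟩
    have hw : ∀ l : List S, wprod (fun s => (A s)ᴴ) l.reverse = (wprod A l)ᴴ := by
      intro l
      induction l with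
      | nil => simp
      | cons s l ih => simp [wprod_append, ih]
    rw [hw] at h0
    simpa using h0

end IsStableFamily

/-! ### Fixed points of Kraus maps and intertwiners. -/

/-- The image of the identity under the `a`-th power of the Kraus map. -/
noncomputable def krausFixedPoint {S b : Type*} [Fintype S] [Fintype b] [DecidableEq b] (κ : ℝ)
    (A : S → Matrix b b ℂ) (a : ℕ) : Matrix b b ℂ :=
  krausMap (κ ^ a) (wordFamily A a) (wordFamily A a) 1

section fixed
variable {S b n : Type*} [Fintype S] [Fintype b] [DecidableEq b] [Fintype n] [DecidableEq n]
  {κ : ℝ} {A : S → Matrix b b ℂ} {B : S → Matrix n n ℂ} {a a' : ℕ}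

theorem krausFixedPoint_isHermitian : (krausFixedPoint κ A a)ᴴ = krausFixedPoint κ A a := by
  rw [krausFixedPoint, krausMap_conjTranspose, Matrix.conjTranspose_one]

theorem krausMatrix_pow_mulVec_vec (q : ℕ) (X : Matrix n b ℂ) :
    krausMatrix κ A B ^ q *ᵥ X.vec = (krausMap (κ ^ q) (wordFamily A q) (wordFamily B q) X).vec := by
  rw [krausMatrix_pow, krausMatrix_mulVec_vec]

theorem IsStableFamily.krausMap_krausFixedPoint (h : IsStableFamily κ A a) :
    krausMap κ A A (krausFixedPoint κ A a) = krausFixedPoint κ A a := by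
  rw [← Matrix.vec_inj, ← krausMatrix_mulVec_vec, krausFixedPoint, ← krausMatrix_pow_mulVec_vec,
    Matrix.mulVec_mulVec, ← pow_succ', h.pow_eq (a + 1) (by omega)]

/-- Both weights are sums of terms `M Mᴴ`, so by cyclicity the trace is a sum of squared Frobenius
norms. Writing it out replaces any appeal to square roots of positive matrices. -/
theorem trace_krausMap_one_mul_krausMap_one {U W : Type*} [Fintype U] [Fintype W] {κ' : ℝ}
    (P : U → Matrix n n ℂ) (Q : W → Matrix b b ℂ) (Z : Matrix n b ℂ) :
    (krausMap κ' P P 1 * Z * krausMap κ Q Q 1 * Zᴴ).trace =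
      ((κ' * κ * ∑ u, ∑ w, ∑ i, ∑ j, ‖((P u)ᴴ * Z * Q w) i j‖ ^ 2 : ℝ) : ℂ) := by
  have hG : ∀ G : Matrix n b ℂ, ((∑ i, ∑ j, ‖G i j‖ ^ 2 : ℝ) : ℂ) = (G * Gᴴ).trace := by
    intro G
    simp [Matrix.trace, Matrix.mul_apply, Complex.mul_conj']
  have hR : ((κ' * κ * ∑ u, ∑ w, ∑ i, ∑ j, ‖((P u)ᴴ * Z * Q w) i j‖ ^ 2 : ℝ) : ℂ) =
      κ' * κ * ∑ u, ∑ w, (((P u)ᴴ * Z * Q w) * ((P u)ᴴ * Z * Q w)ᴴ).trace := by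
    simp only [← hG]; push_cast; rfl
  rw [hR]
  simp only [krausMap, Matrix.mul_one, Matrix.smul_mul, Matrix.mul_smul, Matrix.trace_smul,
    smul_eq_mul]
  suffices h : ((∑ u, P u * (P u)ᴴ) * Z * (∑ w, Q w * (Q w)ᴴ) * Zᴴ).trace =
      ∑ u, ∑ w, (((P u)ᴴ * Z * Q w) * ((P u)ᴴ * Z * Q w)ᴴ).trace by rw [h]; ring
  simp only [Matrix.sum_mul, Matrix.mul_sum, Matrix.trace_sum]
  rw [Finset.sum_comm]
  refine Finset.sum_congr rfl fun u _ => Finset.sum_congr rfl fun w _ => ?_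
  rw [Matrix.conjTranspose_mul, Matrix.conjTranspose_mul, Matrix.conjTranspose_conjTranspose]
  simp only [Matrix.mul_assoc]
  rw [Matrix.trace_mul_comm]
  simp only [Matrix.mul_assoc]

theorem trace_weighted (Z : Matrix n b ℂ) :
    (krausFixedPoint κ (fun s => (B s)ᴴ) a' * Z * krausFixedPoint κ A a * Zᴴ).trace =
      ((κ ^ a' * κ ^ a * ∑ u, ∑ w, ∑ i, ∑ j,
        ‖((wordFamily (fun s => (B s)ᴴ) a' u)ᴴ * Z * wordFamily A a w) i j‖ ^ 2 : ℝ) : ℂ) :=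
  trace_krausMap_one_mul_krausMap_one _ _ _

theorem trace_weighted_nonneg (hκ : 0 < κ) (Z : Matrix n b ℂ) : ∃ r : ℝ, 0 ≤ r ∧
    (krausFixedPoint κ (fun s => (B s)ᴴ) a' * Z * krausFixedPoint κ A a * Zᴴ).trace = r :=
  ⟨_, by positivity, trace_weighted Z⟩

/-- The weighted form is definite: if it vanishes, `Z` is annihilated between all words of lengths
`a'` and `a`, and fullness removes these words one side at a time. -/
theorem eq_zero_of_trace_weighted (hA : IsStableFamily κ A a) (hB : IsStableFamily κ B a')
    {Z : Matrix n b ℂ}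
    (h : (krausFixedPoint κ (fun s => (B s)ᴴ) a' * Z * krausFixedPoint κ A a * Zᴴ).trace = 0) :
    Z = 0 := by
  rw [trace_weighted, Complex.ofReal_eq_zero] at h
  have hκ := hA.pos
  have h1 := (mul_eq_zero.1 h).resolve_left (by positivity)
  have hG : ∀ u w, (wordFamily (fun s => (B s)ᴴ) a' u)ᴴ * Z * wordFamily A a w = 0 := by
    intro u w
    rw [Finset.sum_eq_zero_iff_of_nonneg fun _ _ => by positivity] at h1
    have h2 := h1 u (Finset.mem_univ _)
    rw [Finset.sum_eq_zero_iff_of_nonneg fun _ _ => by positivity] at h2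
    have h3 := h2 w (Finset.mem_univ _)
    ext i j
    rw [Finset.sum_eq_zero_iff_of_nonneg fun _ _ => by positivity] at h3
    have h4 := h3 i (Finset.mem_univ _)
    rw [Finset.sum_eq_zero_iff_of_nonneg fun _ _ => by positivity] at h4
    simpa using h4 j (Finset.mem_univ _)
  refine hA.full.eq_zero_of_mul_wprod hA.exists_wprod_ne_zero fun l hl => ?_
  rw [← Matrix.conjTranspose_eq_zero]
  refine hB.conjTranspose.full.eq_zero_of_mul_wprod hB.conjTranspose.exists_wprod_ne_zero
    fun l' hl' => ?_
  subst hl hl'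
  have := hG l'.get l.get
  simp only [wordFamily, List.ofFn_get] at this
  rw [← Matrix.conjTranspose_eq_zero, Matrix.conjTranspose_mul, Matrix.conjTranspose_conjTranspose,
    ← Matrix.mul_assoc, this]

/-- A left null vector `v`, repeated in every row of `Z`, makes the definite weighted form vanish.
-/
theorem IsStableFamily.isUnit_krausFixedPoint (h : IsStableFamily κ A a) :
    IsUnit (krausFixedPoint κ A a) := by
  rw [← Matrix.vecMul_injective_iff_isUnit]
  rw [← Matrix.coe_vecMulLinear, ← LinearMap.ker_eq_bot, LinearMap.ker_eq_bot']
  intro v hv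
  have hZ : (Matrix.of fun _ : b => v) * krausFixedPoint κ A a = 0 := by
    ext i j
    exact congrFun hv j
  have := eq_zero_of_trace_weighted h h (Z := Matrix.of fun _ : b => v) (by
    rw [Matrix.mul_assoc (krausFixedPoint κ (fun s => (A s)ᴴ) a), hZ]; simp)
  ext j
  exact congrFun (congrFun this j) j

/-- Write `X = Y ρ` and let `Δ_s = Y A_s - B_s Y`. The fixed point equations collapse `κ ∑ Δ_s ρ
Δ_sᴴ` to `E_B(Y ρ Yᴴ) - Y ρ Yᴴ`, whose pairing with the fixed point `σ` of the adjoint map is zero.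
Each summand pairs nonnegatively and definitely with `σ`, so every `Δ_s` vanishes. -/
theorem exists_intertwiner (hA : IsStableFamily κ A a) (hB : IsStableFamily κ B a')
    {X : Matrix n b ℂ} (hX : krausMap κ A B X = X) :
    ∃ Y : Matrix n b ℂ, X = Y * krausFixedPoint κ A a ∧ ∀ s, Y * A s = B s * Y := by
  set ρ := krausFixedPoint κ A a with hρ
  set σ := krausFixedPoint κ (fun s => (B s)ᴴ) a' with hσ
  obtain ⟨u, hu⟩ := hA.isUnit_krausFixedPoint
  obtain ⟨Y, hY⟩ : ∃ Y, Y * ρ = X := ⟨X * ((u⁻¹ : (Matrix b b ℂ)ˣ) : Matrix b b ℂ), by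
    rw [Matrix.mul_assoc, hρ, ← hu, Units.inv_mul, Matrix.mul_one]⟩
  refine ⟨Y, hY.symm, fun s => ?_⟩
  have hρH : ρᴴ = ρ := krausFixedPoint_isHermitian
  have hsum : (κ : ℂ) • ∑ s, (Y * A s - B s * Y) * ρ * (Y * A s - B s * Y)ᴴ =
      krausMap κ B B (Y * ρ * Yᴴ) - Y * ρ * Yᴴ := by
    have e1 : (κ : ℂ) • ∑ s, (Y * A s - B s * Y) * ρ * (Y * A s - B s * Y)ᴴ =
        Y * krausMap κ A A ρ * Yᴴ - Y * krausMap κ B A (ρ * Yᴴ) - krausMap κ A B (Y * ρ) * Yᴴ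
          + krausMap κ B B (Y * ρ * Yᴴ) := by
      simp only [krausMap, Matrix.mul_smul, Matrix.smul_mul, ← smul_sub, ← smul_add, Matrix.mul_sum,
        Matrix.sum_mul, ← Finset.sum_sub_distrib, ← Finset.sum_add_distrib]
      congr 1
      refine Finset.sum_congr rfl fun s _ => ?_
      simp only [Matrix.conjTranspose_sub, Matrix.conjTranspose_mul, Matrix.sub_mul, Matrix.mul_sub,
        Matrix.mul_assoc]
      abel
    have e2 : krausMap κ B A (ρ * Yᴴ) = ρ * Yᴴ := by
      have : ρ * Yᴴ = Xᴴ := by rw [← hY, Matrix.conjTranspose_mul, hρH]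
      rw [this, ← krausMap_conjTranspose, hX]
    rw [e1, e2, hY, hX, hρ, hA.krausMap_krausFixedPoint, ← hρ, ← hY]
    simp only [Matrix.mul_assoc]
    abel
  have htr : (κ : ℂ) * ∑ s, (σ * (Y * A s - B s * Y) * ρ * (Y * A s - B s * Y)ᴴ).trace = 0 := by
    have e3 := congrArg (fun M => (σ * M).trace) hsum
    simp only [Matrix.mul_smul, Matrix.mul_sum, Matrix.trace_smul, Matrix.trace_sum,
      Matrix.mul_sub, Matrix.trace_sub] at e3
    rw [← trace_krausMap_adjoint, hσ, hB.conjTranspose.krausMap_krausFixedPoint, sub_self] at e3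
    rw [← smul_eq_mul, ← e3, ← hσ]
    simp only [Matrix.mul_assoc]
  have hs := (mul_eq_zero.1 htr).resolve_left (by exact_mod_cast hA.pos.ne')
  choose r hr0 hr using fun s => trace_weighted_nonneg (A := A) (B := B) (a := a) (a' := a') hA.pos
    (Y * A s - B s * Y)
  simp only [hσ, hρ, hr] at hs
  rw [← Complex.ofReal_sum, Complex.ofReal_eq_zero,
    Finset.sum_eq_zero_iff_of_nonneg fun s _ => hr0 s] at hs
  have hz := eq_zero_of_trace_weighted hA hB ((hr s).trans (by rw [hs s (Finset.mem_univ _)]; simp))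
  exact sub_eq_zero.1 hz

end fixed

/-! ### Rank-one stationary powers and their spectrum. -/

section rankOne

/-- Exchange the factors of column times row to reach a one-by-one matrix. The extra factor `X`
avoids the exponent `card n - 1`. -/
theorem Matrix.X_mul_charpoly_vecMulVec {n : Type*} [Fintype n] [DecidableEq n] (u v : n → ℂ) :
    Polynomial.X * (vecMulVec u v).charpoly =
      Polynomial.X ^ Fintype.card n * (Polynomial.X - Polynomial.C (v ⬝ᵥ u)) := by
  have := Matrix.charpoly_mul_comm' (replicateCol Unit u) (replicateRow Unit v)
  rw [← Matrix.vecMulVec_eq, Fintype.card_unit, pow_one] at this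
  rw [this]
  congr 1
  rw [Matrix.charpoly, Matrix.det_unique]
  simp

theorem Matrix.charpoly_vecMulVec_spectrum {n : Type*} [Fintype n] [DecidableEq n] {u v : n → ℂ}
    (h : v ⬝ᵥ u = 1) : (vecMulVec u v).charpoly.rootMultiplicity 1 = 1 ∧
      ∀ z : ℂ, (vecMulVec u v).charpoly.IsRoot z → z = 1 ∨ ‖z‖ < 1 := by
  have key := Matrix.X_mul_charpoly_vecMulVec u v
  rw [h] at key
  have hne : (vecMulVec u v).charpoly ≠ 0 := (Matrix.charpoly_monic _).ne_zero
  have hX0 : (Polynomial.X : Polynomial ℂ).rootMultiplicity 1 = 0 :=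
    Polynomial.rootMultiplicity_eq_zero (by simp)
  constructor
  · have h1 := congrArg (Polynomial.rootMultiplicity 1) key
    have hX1 : (Polynomial.X ^ Fintype.card n : Polynomial ℂ).rootMultiplicity 1 = 0 :=
      Polynomial.rootMultiplicity_eq_zero (by simp)
    rw [Polynomial.rootMultiplicity_mul (mul_ne_zero Polynomial.X_ne_zero hne),
      Polynomial.rootMultiplicity_mul (mul_ne_zero (pow_ne_zero _ Polynomial.X_ne_zero)
        (Polynomial.X_sub_C_ne_zero 1)), hX0, hX1,
      Polynomial.rootMultiplicity_X_sub_C_self] at h1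
    omega
  · intro z hz
    have h1 := congrArg (Polynomial.eval z) key
    rw [Polynomial.eval_mul, hz.eq_zero, mul_zero] at h1
    simp only [Polynomial.eval_mul, Polynomial.eval_pow, Polynomial.eval_X, Polynomial.eval_sub,
      Polynomial.eval_C] at h1
    rcases mul_eq_zero.1 h1.symm with h2 | h2
    · right; rw [eq_zero_of_pow_eq_zero h2]; simp
    · left; exact sub_eq_zero.1 h2

variable {S b n : Type*} [Fintype S] [Fintype b] [DecidableEq b] [Fintype n] [DecidableEq n]
  {κ : ℝ} {A : S → Matrix b b ℂ} {B : S → Matrix n n ℂ} {a a' : ℕ}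

/-- The stationary power maps any `X` to a fixed point `Y ρ` with `Y` commuting with the family, so
`Y` is a scalar. The invariant functional `tr(σ ·)` determines it, whence `v` is that functional
divided by `tr(σ ρ)`; the last clause is the definiteness of the weighted form. -/
theorem IsStableFamily.pow_eq_vecMulVec [Nonempty b] (h : IsStableFamily κ A a) :
    ∃ v : b × b → ℂ, v ⬝ᵥ (krausFixedPoint κ A a).vec = 1 ∧
      krausMatrix κ A A ^ a = vecMulVec (krausFixedPoint κ A a).vec v ∧
      ∀ Z : Matrix b b ℂ, v ⬝ᵥ (Z * krausFixedPoint κ A a * Zᴴ).vec = 0 → Z = 0 := by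
  set ρ := krausFixedPoint κ A a with hρ
  set σ := krausFixedPoint κ (fun s => (A s)ᴴ) a with hσ
  have hσH : σᴴ = σ := krausFixedPoint_isHermitian
  have hdot : ∀ X : Matrix b b ℂ, star σ.vec ⬝ᵥ X.vec = (σ * X).trace := by
    intro X; rw [Matrix.star_vec_dotProduct_vec, hσH]
  have hfix : star σ.vec ᵥ* krausMatrix κ A A = star σ.vec := by
    rw [← Matrix.conjTranspose_conjTranspose (krausMatrix κ A A), ← Matrix.star_mulVec,
      krausMatrix_conjTranspose, krausMatrix_mulVec_vec, hσ,
      h.conjTranspose.krausMap_krausFixedPoint]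
  have hfixpow : ∀ m, star σ.vec ᵥ* krausMatrix κ A A ^ m = star σ.vec := by
    intro m
    induction m with
    | zero => simp
    | succ m ih => rw [pow_succ, ← Matrix.vecMul_vecMul, ih, hfix]
  have hθ : (σ * ρ).trace ≠ 0 := by
    intro h0
    have := eq_zero_of_trace_weighted h h (Z := 1) (by simpa using h0)
    exact one_ne_zero this
  refine ⟨(σ * ρ).trace⁻¹ • star σ.vec, ?_, ?_, ?_⟩
  · rw [smul_dotProduct, hdot, smul_eq_mul, inv_mul_cancel₀ hθ]
  · have hX : ∀ X : Matrix b b ℂ, krausMatrix κ A A ^ a *ᵥ X.vec =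
        vecMulVec ρ.vec ((σ * ρ).trace⁻¹ • star σ.vec) *ᵥ X.vec := by
      intro X
      set F := krausMap (κ ^ a) (wordFamily A a) (wordFamily A a) X with hF
      have hFvec : krausMatrix κ A A ^ a *ᵥ X.vec = F.vec := krausMatrix_pow_mulVec_vec _ _
      have hFfix : krausMap κ A A F = F := by
        rw [← Matrix.vec_inj, ← krausMatrix_mulVec_vec, ← hFvec, Matrix.mulVec_mulVec, ← pow_succ',
          h.pow_eq (a + 1) (by omega)]
      obtain ⟨Y, hY, hcomm⟩ := exists_intertwiner h h hFfix
      obtain ⟨c, rfl⟩ := h.full.eq_smul_one_of_commute hcomm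
      rw [Matrix.smul_mul, Matrix.one_mul, ← hρ] at hY
      have hc : star σ.vec ⬝ᵥ X.vec = c * (σ * ρ).trace := by
        rw [← hfixpow a, ← Matrix.dotProduct_mulVec, hFvec, hdot, hY, Matrix.mul_smul,
          Matrix.trace_smul, smul_eq_mul]
      rw [hFvec, hY, Matrix.vecMulVec_mulVec, smul_dotProduct, hc, Matrix.vec_smul]
      simp only [smul_eq_mul, op_smul_eq_smul]
      congr 1
      field_simp
    have hall : ∀ x, krausMatrix κ A A ^ a *ᵥ x =
        vecMulVec ρ.vec ((σ * ρ).trace⁻¹ • star σ.vec) *ᵥ x := by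
      intro x
      obtain ⟨X, rfl⟩ := Matrix.vec_bijective.2 x
      exact hX X
    exact Matrix.mulVec_injective (funext hall)
  · intro Z hZ
    rw [smul_dotProduct, hdot, smul_eq_mul] at hZ
    have := (mul_eq_zero.1 hZ).resolve_left (inv_ne_zero hθ)
    exact eq_zero_of_trace_weighted h h (by rw [← this]; simp only [Matrix.mul_assoc]; rfl)

theorem IsStableFamily.trace_pow [Nonempty b] (h : IsStableFamily κ A a) :
    (krausMatrix κ A A ^ a).trace = 1 := by
  obtain ⟨v, hv, hE, _⟩ := h.pow_eq_vecMulVec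
  rw [hE, Matrix.trace_vecMulVec, dotProduct_comm, hv]

theorem IsStableFamily.of_le [Nonempty b] (h : IsStableFamily κ A a) {q : ℕ} (hq : a ≤ q) :
    IsStableFamily κ A q where
  pos := h.pos
  full := h.full
  pow_eq m hm := by rw [h.pow_eq m (hq.trans hm), h.pow_eq q hq]
  exists_wprod_ne_zero := by
    by_contra! hcon
    have := h.trace_pow
    rw [← h.pow_eq q hq, trace_krausMatrix_pow] at this
    simp [wordFamily, hcon _ (List.length_ofFn)] at this

/-- The stationary map sends `P ρ Pᴴ` to a multiple of `ρ` annihilated by `1 - P`. Either the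
multiple is zero, and definiteness gives `P = 0`, or invertibility of `ρ` gives `P = 1`. -/
theorem IsStableFamily.eq_zero_or_one_of_invariant [Nonempty b] (h : IsStableFamily κ A a)
    {P : Matrix b b ℂ} (hP : ∀ w, wordFamily A a w * P = P * wordFamily A a w * P) :
    P = 0 ∨ P = 1 := by
  obtain ⟨v, hv, hE, hdef⟩ := h.pow_eq_vecMulVec
  set ρ := krausFixedPoint κ A a with hρ
  have h1 : (1 - P) * krausMap (κ ^ a) (wordFamily A a) (wordFamily A a) (P * ρ * Pᴴ) = 0 := by
    rw [krausMap, Matrix.mul_smul, Matrix.mul_sum, Finset.sum_eq_zero, smul_zero]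
    intro w _
    have : (1 - P) * (wordFamily A a w * P) = 0 := by
      rw [Matrix.sub_mul, Matrix.one_mul, ← Matrix.mul_assoc, ← hP w, sub_self]
    calc (1 - P) * (wordFamily A a w * (P * ρ * Pᴴ) * (wordFamily A a w)ᴴ)
        = ((1 - P) * (wordFamily A a w * P)) * (ρ * Pᴴ * (wordFamily A a w)ᴴ) := by
          simp only [Matrix.mul_assoc]
      _ = 0 := by rw [this, Matrix.zero_mul]
  have h2 : krausMap (κ ^ a) (wordFamily A a) (wordFamily A a) (P * ρ * Pᴴ) =
      (v ⬝ᵥ (P * ρ * Pᴴ).vec) • ρ := by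
    rw [← Matrix.vec_inj, ← krausMatrix_pow_mulVec_vec, hE, Matrix.vecMulVec_mulVec,
      Matrix.vec_smul, op_smul_eq_smul]
  rw [h2, Matrix.mul_smul, smul_eq_zero] at h1
  rcases h1 with h1 | h1
  · exact Or.inl (hdef P h1)
  · right
    have := h.isUnit_krausFixedPoint.mul_left_eq_zero.1 h1
    exact (sub_eq_zero.1 this).symm

/-- A nonzero fixed point would supply an invertible intertwiner. So `1` is not an eigenvalue, `E -
1` is invertible, and nilpotency of `E (E - 1)` makes `E` nilpotent. -/
theorem trace_krausMatrix_eq_zero (hA : IsStableFamily κ A a) (hB : IsStableFamily κ B a')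
    (hnil : IsNilpotent (krausMatrix κ A B ^ 2 - krausMatrix κ A B))
    (hAB : ¬ ∃ (Y : Matrix n b ℂ) (Y' : Matrix b n ℂ), Y' * Y = 1 ∧ Y * Y' = 1 ∧
      ∀ s, Y * A s = B s * Y) :
    (krausMatrix κ A B).trace = 0 := by
  have hinj : ∀ X : Matrix n b ℂ, krausMap κ A B X = X → X = 0 := by
    intro X hX
    obtain ⟨Y, rfl, hY⟩ := exists_intertwiner hA hB hX
    by_contra hne
    have hY0 : Y ≠ 0 := by rintro rfl; simp at hne
    obtain ⟨Y', h1, h2⟩ := hA.full.exists_inverse_of_intertwine hB.full hY0 hY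
    exact hAB ⟨Y, Y', h1, h2, hY⟩
  have hunit : IsUnit (krausMatrix κ A B - 1) := by
    rw [← Matrix.mulVec_injective_iff_isUnit, ← Matrix.coe_mulVecLin, ← LinearMap.ker_eq_bot,
      LinearMap.ker_eq_bot']
    intro x hx
    obtain ⟨X, rfl⟩ := Matrix.vec_bijective.2 x
    rw [Matrix.mulVecLin_apply, Matrix.sub_mulVec, Matrix.one_mulVec, krausMatrix_mulVec_vec,
      sub_eq_zero, Matrix.vec_inj] at hx
    rw [hinj X hx, Matrix.vec_zero]
  have hnil' : IsNilpotent (krausMatrix κ A B) := by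
    have e : krausMatrix κ A B ^ 2 - krausMatrix κ A B =
      krausMatrix κ A B * (krausMatrix κ A B - 1) := by noncomm_ring
    obtain ⟨m, hm⟩ := hnil
    refine ⟨m, ?_⟩
    rw [e, (show Commute (krausMatrix κ A B) (krausMatrix κ A B - 1) from
      (Commute.refl _).sub_right (Commute.one_right _)).mul_pow] at hm
    exact (hunit.pow m).mul_left_eq_zero.1 hm
  exact (Matrix.isNilpotent_trace_of_isNilpotent hnil').eq_zero

end rankOne

/-! ### Double tensors, transfer matrices and blocking. -/

namespace MPOTensor
variable {b b' O I : Type*}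

/-- The family of all matrices of a tensor. -/
def flat (A : MPOTensor b O I) : O × I → Matrix b b ℂ := fun s => A s.1 s.2

/-- The mixed transfer matrix of two tensors. -/
noncomputable def mixedTransfer [Fintype O] [Fintype I] (A : MPOTensor b O I)
    (B : MPOTensor b' O I) : Matrix (b × b') (b × b') ℂ :=
  (Fintype.card I : ℂ)⁻¹ • ∑ i, double A B i i

theorem mixedTransfer_eq_krausMatrix [Fintype O] [Fintype I] (A : MPOTensor b O I)
    (B : MPOTensor b' O I) :
    mixedTransfer A B = krausMatrix ((Fintype.card I : ℝ)⁻¹) A.flat B.flat := by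
  rw [mixedTransfer, krausMatrix, Fintype.sum_prod_type_right]
  push_cast
  rfl

variable [Fintype b] [DecidableEq b] [Fintype b'] [DecidableEq b']

theorem word_eq_wprod (A : MPOTensor b O I) {N : ℕ} (o : Fin N → O) (i : Fin N → I) :
    A.word o i = wprod A.flat (List.ofFn fun s => (o s, i s)) := by
  rw [word, wprod, List.map_ofFn]; rfl

theorem double_block [Fintype O] (A : MPOTensor b O I) (B : MPOTensor b' O I) {q : ℕ}
    (i i' : Fin q → I) :
    double (A.block q) (B.block q) i i' =
      wprod (fun s : I × I => double A B s.1 s.2) (List.ofFn fun s => (i s, i' s)) := by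
  simp only [double, block, word]
  rw [wprod, List.map_ofFn]
  simp only [kronecker_prod_ofFn]
  exact sum_prod_ofFn fun s o => (A o (i s)).map star ⊗ₖ B o (i' s)

theorem mixedTransfer_block [Fintype O] [Fintype I] (A : MPOTensor b O I) (B : MPOTensor b' O I)
    (q : ℕ) : mixedTransfer (A.block q) (B.block q) = mixedTransfer A B ^ q := by
  rw [mixedTransfer, mixedTransfer, smul_pow, Fintype.card_fun, Fintype.card_fin]
  push_cast
  rw [inv_pow]
  congr 1
  have : ∀ M : Matrix (b × b') (b × b') ℂ, M ^ q = (List.ofFn fun _ : Fin q => M).prod := by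
    intro M; simp [List.ofFn_const]
  rw [this, ← sum_prod_ofFn]
  refine Finset.sum_congr rfl fun i _ => ?_
  rw [double_block, wprod, List.map_ofFn]
  rfl

theorem conjTranspose_mpo_mul_mpo [Fintype O] (A : MPOTensor b O I) (B : MPOTensor b' O I) {N : ℕ}
    (i i' : Fin N → I) :
    ((A.mpo N)ᴴ * B.mpo N) i i' = (double (A.block N) (B.block N) i i').trace := by
  simp only [Matrix.mul_apply, Matrix.conjTranspose_apply, mpo, double, block, Matrix.trace_sum,
    Matrix.trace_kronecker]
  refine Finset.sum_congr rfl fun o _ => ?_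
  congr 1
  simp [Matrix.trace]

theorem conjTranspose_mpo_mul_mpo_eq_wprod [Fintype O] (A : MPOTensor b O I)
    (B : MPOTensor b' O I) {N : ℕ} (i i' : Fin N → I) :
    ((A.mpo N)ᴴ * B.mpo N) i i' =
      (wprod (fun s : I × I => double A B s.1 s.2) (List.ofFn fun s => (i s, i' s))).trace := by
  rw [conjTranspose_mpo_mul_mpo, double_block]

theorem block_flat_eq_wordFamily (A : MPOTensor b O I) (q : ℕ) (o : Fin q → O) (i : Fin q → I) :
    A.block q o i = wordFamily A.flat q fun s => (o s, i s) := word_eq_wprod _ _ _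

theorem isNormal_block [Fintype O] [Fintype I] [Nonempty b] {A : MPOTensor b O I} {q : ℕ}
    (h : IsStableFamily ((Fintype.card I : ℝ)⁻¹) A.flat q) : (A.block q).IsNormal := by
  have hE : (A.block q).transfer = krausMatrix ((Fintype.card I : ℝ)⁻¹) A.flat A.flat ^ q := by
    rw [← mixedTransfer_eq_krausMatrix, ← mixedTransfer_block]; rfl
  obtain ⟨v, hv, hE', _⟩ := h.pow_eq_vecMulVec
  refine ⟨fun P _ hP => h.eq_zero_or_one_of_invariant fun w => ?_, ?_⟩
  · have := hP (fun s => (w s).1) (fun s => (w s).2)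
    simpa only [block_flat_eq_wordFamily] using this
  · rw [hE, hE']
    exact Matrix.charpoly_vecMulVec_spectrum hv

end MPOTensor

/-! ### Triangularization along invariant subspaces. -/

section composition
variable {S b n : Type*} [Fintype b] [DecidableEq b] [Fintype n] [DecidableEq n]

/-- Adapted bases of an invariant subspace and of a complement, in matrix form. -/
theorem exists_adapted_matrices {N : ℕ} (p : Submodule ℂ (Fin N → ℂ)) (hbot : p ≠ ⊥) (htop : p ≠ ⊤) :
    ∃ (n₁ n₂ : ℕ) (R₁ : Matrix (Fin N) (Fin n₁) ℂ) (L₁ : Matrix (Fin n₁) (Fin N) ℂ)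
      (R₂ : Matrix (Fin N) (Fin n₂) ℂ) (L₂ : Matrix (Fin n₂) (Fin N) ℂ),
      n₁ < N ∧ n₂ < N ∧ n₁ + n₂ = N ∧ L₁ * R₁ = 1 ∧ L₂ * R₂ = 1 ∧ L₂ * R₁ = 0 ∧
      R₁ * L₁ + R₂ * L₂ = 1 ∧
      ∀ M : Matrix (Fin N) (Fin N) ℂ, (∀ v ∈ p, M *ᵥ v ∈ p) → L₂ * M * R₁ = 0 := by
  obtain ⟨q, hpq⟩ := p.exists_isCompl
  let bE := Pi.basisFun ℂ (Fin N)
  let b₁ := Module.finBasis ℂ p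
  let b₂ := Module.finBasis ℂ q
  let f₁ : (Fin N → ℂ) →ₗ[ℂ] p := p.projectionOnto q hpq
  let f₂ : (Fin N → ℂ) →ₗ[ℂ] q := q.projectionOnto p hpq.symm
  have hsum : Module.finrank ℂ p + Module.finrank ℂ q = N := by
    rw [Submodule.finrank_add_eq_of_isCompl hpq]; simp
  have hp : 0 < Module.finrank ℂ p := Module.finrank_pos_iff.2 (Submodule.nontrivial_iff_ne_bot.2 hbot)
  have hq : Module.finrank ℂ p < N := by
    have := Submodule.finrank_lt htop; simpa using this
  refine ⟨_, _, LinearMap.toMatrix b₁ bE p.subtype, LinearMap.toMatrix bE b₁ f₁,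
    LinearMap.toMatrix b₂ bE q.subtype, LinearMap.toMatrix bE b₂ f₂, hq, by omega, hsum,
    ?_, ?_, ?_, ?_, ?_⟩
  · rw [← LinearMap.toMatrix_comp, ← LinearMap.toMatrix_id b₁]
    congr 1
    ext x; simp [f₁]
  · rw [← LinearMap.toMatrix_comp, ← LinearMap.toMatrix_id b₂]
    congr 1
    ext x; simp [f₂]
  · rw [← LinearMap.toMatrix_comp, ← map_zero (LinearMap.toMatrix b₁ b₂)]
    congr 1
    ext x; simp [f₂]
  · rw [← LinearMap.toMatrix_comp, ← LinearMap.toMatrix_comp, ← map_add, ← LinearMap.toMatrix_id bE]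
    congr 1
    refine LinearMap.ext fun x => ?_
    exact Submodule.projection_add_projection_eq_self hpq x
  · intro M hM
    have : M = LinearMap.toMatrix bE bE (Matrix.toLin' M) := by
      rw [LinearMap.toMatrix_eq_toMatrix', LinearMap.toMatrix'_toLin']
    rw [this, ← LinearMap.toMatrix_comp, ← LinearMap.toMatrix_comp,
      ← map_zero (LinearMap.toMatrix b₁ b₂)]
    congr 1
    refine LinearMap.ext fun x => ?_
    exact (Submodule.projectionOnto_apply_eq_zero_iff hpq.symm).2 (hM x x.2)

theorem Matrix.mul_eq_of_split {N n₁ n₂ x y : Type*} [Fintype N] [DecidableEq N] [Fintype n₁]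
    [Fintype n₂] {R₁ : Matrix N n₁ ℂ} {L₁ : Matrix n₁ N ℂ} {R₂ : Matrix N n₂ ℂ} {L₂ : Matrix n₂ N ℂ}
    (h : R₁ * L₁ + R₂ * L₂ = 1) (P : Matrix x N ℂ) (Q : Matrix N y ℂ) :
    P * Q = P * R₁ * (L₁ * Q) + P * R₂ * (L₂ * Q) := by
  rw [Matrix.mul_assoc, Matrix.mul_assoc, ← Matrix.mul_add, ← Matrix.mul_assoc, ← Matrix.mul_assoc,
    ← Matrix.add_mul, h, Matrix.one_mul]

/-- In adapted bases all letters are block upper triangular, and the diagonal blocks of such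
matrices multiply independently. -/
theorem wprod_compress {N n₁ n₂ : Type*} [Fintype N] [DecidableEq N] [Fintype n₁] [DecidableEq n₁]
    [Fintype n₂] [DecidableEq n₂] {A : S → Matrix N N ℂ}
    {R₁ : Matrix N n₁ ℂ} {L₁ : Matrix n₁ N ℂ} {R₂ : Matrix N n₂ ℂ} {L₂ : Matrix n₂ N ℂ}
    (h₁ : L₁ * R₁ = 1) (h₂ : L₂ * R₂ = 1) (h₂₁ : L₂ * R₁ = 0) (h : R₁ * L₁ + R₂ * L₂ = 1)
    (hA : ∀ s, L₂ * A s * R₁ = 0) (l : List S) :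
    wprod (fun s => L₁ * A s * R₁) l = L₁ * wprod A l * R₁ ∧
    wprod (fun s => L₂ * A s * R₂) l = L₂ * wprod A l * R₂ ∧ L₂ * wprod A l * R₁ = 0 := by
  induction l with
  | nil => simp [h₁, h₂, h₂₁]
  | cons s l ih =>
    obtain ⟨i1, i2, i3⟩ := ih
    simp only [wprod_cons, i1, i2]
    refine ⟨?_, ?_, ?_⟩
    · rw [← Matrix.mul_assoc L₁ (A s), Matrix.mul_assoc (L₁ * A s) (wprod A l),
        Matrix.mul_eq_of_split h (L₁ * A s) (wprod A l * R₁), ← Matrix.mul_assoc L₂, i3]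
      simp [Matrix.mul_assoc]
    · rw [← Matrix.mul_assoc L₂ (A s), Matrix.mul_assoc (L₂ * A s) (wprod A l),
        Matrix.mul_eq_of_split h (L₂ * A s) (wprod A l * R₂), hA]
      simp [Matrix.mul_assoc]
    · rw [← Matrix.mul_assoc L₂ (A s), Matrix.mul_assoc (L₂ * A s) (wprod A l),
        Matrix.mul_eq_of_split h (L₂ * A s) (wprod A l * R₁), hA, ← Matrix.mul_assoc L₂, i3]
      simp

/-- The traces of all nonempty words decompose into those of irreducible families. -/
theorem exists_irreducible_decomposition (N : ℕ) (A : S → Matrix (Fin N) (Fin N) ℂ) :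
    ∃ (ι : Type) (_ : Fintype ι) (d : ι → ℕ) (B : (k : ι) → S → Matrix (Fin (d k)) (Fin (d k)) ℂ),
      (∀ k, IsIrredFamily (B k)) ∧ ∑ k, d k ≤ N ∧
      ∀ l : List S, l ≠ [] → (wprod A l).trace = ∑ k, (wprod (B k) l).trace := by
  induction N using Nat.strong_induction_on with
  | _ N ih =>
    by_cases h0 : ∀ s, A s = 0
    · refine ⟨Empty, inferInstance, Empty.elim, fun k => k.elim, fun k => k.elim, by simp, ?_⟩
      intro l hl
      obtain ⟨s, l', rfl⟩ := List.exists_cons_of_ne_nil hl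
      simp [h0]
    push Not at h0
    by_cases hirr : IsIrredFamily A
    · exact ⟨Unit, inferInstance, fun _ => N, fun _ => A, fun _ => hirr, by simp, by simp⟩
    obtain ⟨p, hp, hbot, htop⟩ : ∃ p : Submodule ℂ (Fin N → ℂ), (∀ s, ∀ v ∈ p, A s *ᵥ v ∈ p) ∧
        p ≠ ⊥ ∧ p ≠ ⊤ := by
      by_contra! hcon
      exact hirr ⟨h0, fun p hp => or_iff_not_imp_left.2 (hcon p hp)⟩
    obtain ⟨n₁, n₂, R₁, L₁, R₂, L₂, hn₁, hn₂, hn, h₁, h₂, h₂₁, hid, hM⟩ :=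
      exists_adapted_matrices p hbot htop
    have hA := fun s => hM (A s) (hp s)
    obtain ⟨ι₁, _, d₁, B₁, hB₁, hd₁, ht₁⟩ := ih n₁ hn₁ fun s => L₁ * A s * R₁
    obtain ⟨ι₂, _, d₂, B₂, hB₂, hd₂, ht₂⟩ := ih n₂ hn₂ fun s => L₂ * A s * R₂
    refine ⟨ι₁ ⊕ ι₂, inferInstance, Sum.elim d₁ d₂, fun k => match k with
      | Sum.inl k => B₁ k
      | Sum.inr k => B₂ k, ?_, ?_, ?_⟩
    · rintro (k | k)
      · exact hB₁ k
      · exact hB₂ k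
    · simp only [Fintype.sum_sum_type, Sum.elim_inl, Sum.elim_inr]; omega
    · intro l hl
      obtain ⟨c1, c2, -⟩ := wprod_compress h₁ h₂ h₂₁ hid hA l
      rw [Fintype.sum_sum_type]
      refine Eq.trans ?_ (congrArg₂ (· + ·) (ht₁ l hl) (ht₂ l hl))
      rw [c1, c2, Matrix.trace_mul_comm _ R₁, Matrix.trace_mul_comm _ R₂, ← Matrix.mul_assoc,
        ← Matrix.mul_assoc, ← Matrix.trace_add, ← Matrix.add_mul, hid, Matrix.one_mul]

end composition

/-! ### Gauge equivalence and direct sums with multiplicities. -/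

namespace MPOTensor
section gauge
variable {b b' b'' O I : Type*} [Fintype b] [DecidableEq b] [Fintype b'] [DecidableEq b']
  [Fintype b''] [DecidableEq b'']

theorem GaugeEquiv.trans {A : MPOTensor b O I} {B : MPOTensor b' O I} {C : MPOTensor b'' O I}
    (h : GaugeEquiv A B) (h' : GaugeEquiv B C) : GaugeEquiv A C := by
  obtain ⟨X, Y, hXY, hYX, hA⟩ := h
  obtain ⟨X', Y', hXY', hYX', hB⟩ := h'
  refine ⟨X * X', Y' * Y, ?_, ?_, fun o i => ?_⟩
  · rw [Matrix.mul_assoc, ← Matrix.mul_assoc X', hXY', Matrix.one_mul, hXY]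
  · rw [Matrix.mul_assoc, ← Matrix.mul_assoc Y, hYX, Matrix.one_mul, hYX']
  · rw [hA, hB]; simp only [Matrix.mul_assoc]

theorem GaugeEquiv.block {A : MPOTensor b O I} {B : MPOTensor b' O I} (h : GaugeEquiv A B) (q : ℕ) :
    GaugeEquiv (A.block q) (B.block q) := by
  obtain ⟨X, Y, hXY, hYX, hA⟩ := h
  refine ⟨X, Y, hXY, hYX, fun o i => ?_⟩
  have hi : ∀ s : O × I, Y * A.flat s = B.flat s * Y := fun s => by
    change Y * A s.1 s.2 = B s.1 s.2 * Y
    rw [hA, ← Matrix.mul_assoc, ← Matrix.mul_assoc, hYX, Matrix.one_mul]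
  rw [MPOTensor.block, MPOTensor.block, word_eq_wprod, word_eq_wprod, Matrix.mul_assoc,
    ← wprod_intertwine hi, ← Matrix.mul_assoc, hXY, Matrix.one_mul]

theorem GaugeEquiv.card_eq {A : MPOTensor b O I} {B : MPOTensor b' O I} (h : GaugeEquiv A B) :
    Fintype.card b = Fintype.card b' := by
  obtain ⟨X, Y, hXY, hYX, -⟩ := h
  have := Matrix.trace_mul_comm X Y
  rw [hXY, hYX, Matrix.trace_one, Matrix.trace_one] at this
  exact_mod_cast this

theorem GaugeEquiv.trace_wprod {A : MPOTensor b O I} {B : MPOTensor b' O I} (h : GaugeEquiv A B)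
    (l : List (O × I)) : (wprod A.flat l).trace = (wprod B.flat l).trace := by
  obtain ⟨X, Y, hXY, hYX, hA⟩ := h
  have hi : ∀ s : O × I, Y * A.flat s = B.flat s * Y := fun s => by
    change Y * A s.1 s.2 = B s.1 s.2 * Y
    rw [hA, ← Matrix.mul_assoc, ← Matrix.mul_assoc, hYX, Matrix.one_mul]
  rw [← Matrix.one_mul (wprod A.flat l), ← hXY, Matrix.mul_assoc, wprod_intertwine hi,
    Matrix.trace_mul_comm, Matrix.mul_assoc, hYX, Matrix.mul_one]

theorem gaugeEquiv_of_submatrix {A : MPOTensor b O I} {B : MPOTensor b' O I} (f : b ≃ b')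
    (h : ∀ o i, A o i = (B o i).submatrix f f) : GaugeEquiv A B := by
  refine ⟨(1 : Matrix b' b' ℂ).submatrix f id, (1 : Matrix b' b' ℂ).submatrix id f, ?_, ?_, ?_⟩
  · ext x y
    simp [Matrix.mul_apply, Matrix.one_apply]
  · rw [Matrix.submatrix_mul_equiv]; simp
  · intro o i
    rw [h]
    ext x y
    simp [Matrix.mul_apply, Matrix.submatrix_apply, Matrix.one_apply]

end gauge

section directSum
variable {O I ι : Type*} [Fintype ι] [DecidableEq ι] {d d' : ι → ℕ}

theorem gaugeEquiv_blockDiagonal' {A : (k : ι) → MPOTensor (Fin (d k)) O I}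
    {B : (k : ι) → MPOTensor (Fin (d' k)) O I} (h : ∀ k, GaugeEquiv (A k) (B k)) :
    GaugeEquiv (fun o i => Matrix.blockDiagonal' fun k => A k o i)
      (fun o i => Matrix.blockDiagonal' fun k => B k o i) := by
  choose X Y hXY hYX hA using h
  refine ⟨Matrix.blockDiagonal' X, Matrix.blockDiagonal' Y, ?_, ?_, fun o i => ?_⟩
  · rw [← Matrix.blockDiagonal'_mul]; simp only [hXY]; exact Matrix.blockDiagonal'_one
  · rw [← Matrix.blockDiagonal'_mul]; simp only [hYX]; exact Matrix.blockDiagonal'_one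
  · rw [← Matrix.blockDiagonal'_mul, ← Matrix.blockDiagonal'_mul]; simp only [hA]

theorem wprod_blockDiagonal' (A : (k : ι) → MPOTensor (Fin (d k)) O I) (l : List (O × I)) :
    wprod (MPOTensor.flat fun o i => Matrix.blockDiagonal' fun k => A k o i) l =
      Matrix.blockDiagonal' fun k => wprod (A k).flat l := by
  induction l with
  | nil => exact Matrix.blockDiagonal'_one.symm
  | cons s l ih => simp only [wprod_cons, ih, Matrix.blockDiagonal'_mul]; rfl

theorem word_multSum {g : ℕ} (m d : Fin g → ℕ) (B : (j : Fin g) → MPOTensor (Fin (d j)) O I)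
    (l : List (O × I)) :
    wprod (multSum m d B).flat l =
      Matrix.blockDiagonal' fun j => (1 : Matrix (Fin (m j)) (Fin (m j)) ℂ) ⊗ₖ wprod (B j).flat l := by
  induction l with
  | nil => simp only [wprod_nil, Matrix.one_kronecker_one]; exact Matrix.blockDiagonal'_one.symm
  | cons s l ih =>
    have : ∀ j, (1 : Matrix (Fin (m j)) (Fin (m j)) ℂ) ⊗ₖ ((B j).flat s * wprod (B j).flat l) =
        ((1 : Matrix (Fin (m j)) (Fin (m j)) ℂ) ⊗ₖ (B j).flat s) *
        ((1 : Matrix (Fin (m j)) (Fin (m j)) ℂ) ⊗ₖ wprod (B j).flat l) := fun j => by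
      rw [← Matrix.mul_kronecker_mul, Matrix.one_mul]
    simp only [wprod_cons, ih, this, Matrix.blockDiagonal'_mul]
    rfl

theorem mpo_multSum {g : ℕ} (m d : Fin g → ℕ) (B : (j : Fin g) → MPOTensor (Fin (d j)) O I)
    (N : ℕ) : (multSum m d B).mpo N = ∑ j, (m j : ℂ) • (B j).mpo N := by
  ext o i
  simp only [mpo, word_eq_wprod, word_multSum, Matrix.trace_blockDiagonal', Matrix.trace_kronecker,
    Matrix.trace_one, Matrix.sum_apply, Matrix.smul_apply, smul_eq_mul, Fintype.card_fin]

theorem block_multSum {g : ℕ} (m d : Fin g → ℕ) (B : (j : Fin g) → MPOTensor (Fin (d j)) O I)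
    (q : ℕ) : (multSum m d B).block q = multSum m d fun j => (B j).block q := by
  funext o i
  rw [block, word_eq_wprod, word_multSum]
  simp only [multSum, block, word_eq_wprod]

theorem multSum_apply_ne {g : ℕ} (m d : Fin g → ℕ) (B : (j : Fin g) → MPOTensor (Fin (d j)) O I)
    (o : O) (i : I) {j j' : Fin g} {a : Fin (m j)} {a' : Fin (m j')} (x : Fin (d j)) (x' : Fin (d j'))
    (h : (⟨j, a⟩ : (j : Fin g) × Fin (m j)) ≠ ⟨j', a'⟩) :
    multSum m d B o i ⟨j, (a, x)⟩ ⟨j', (a', x')⟩ = 0 := by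
  by_cases hj : j = j'
  · subst hj
    have : a ≠ a' := fun h' => h (by rw [h'])
    simp [multSum, Matrix.blockDiagonal'_apply_eq, this]
  · exact Matrix.blockDiagonal'_apply_ne _ _ _ hj

/-- A direct sum of tensors, each gauge equivalent to its class representative, is gauge equivalent
to the sum of the representatives with multiplicities. -/
theorem gaugeEquiv_multSum {g : ℕ} {dB : Fin g → ℕ} {A : (k : ι) → MPOTensor (Fin (d k)) O I}
    {B : (j : Fin g) → MPOTensor (Fin (dB j)) O I} (cls : ι → Fin g)
    (h : ∀ k, GaugeEquiv (A k) (B (cls k))) :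
    GaugeEquiv (fun o i => Matrix.blockDiagonal' fun k => A k o i)
      (multSum (fun j => Fintype.card {k // cls k = j}) dB B) := by
  refine (gaugeEquiv_blockDiagonal' h).trans ?_
  let m : Fin g → ℕ := fun j => Fintype.card {k // cls k = j}
  -- Numbering the members of each class turns the direct sum over `k` into a double sum over
  -- classes and copies; the gauge is the resulting permutation of the basis.
  let e : ι ≃ (j : Fin g) × Fin (m j) := (Equiv.sigmaFiberEquiv cls).symm.trans
    (Equiv.sigmaCongrRight fun j => Fintype.equivFin _)
  let idx : (k : ι) → Fin (m (cls k)) := fun k => Fintype.equivFin {k' // cls k' = cls k} ⟨k, rfl⟩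
  have he : ∀ k, e k = ⟨cls k, idx k⟩ := fun k => rfl
  let f : ((k : ι) × Fin (dB (cls k))) → (j : Fin g) × (Fin (m j) × Fin (dB j)) :=
    fun x => ⟨cls x.1, (idx x.1, x.2)⟩
  have hf : Function.Bijective f := by
    constructor
    · rintro ⟨k, x⟩ ⟨k', x'⟩ hx
      have h1 := congrArg (fun y : (j : Fin g) × (Fin (m j) × Fin (dB j)) =>
        (⟨y.1, y.2.1⟩ : (j : Fin g) × Fin (m j))) hx
      change (⟨cls k, idx k⟩ : (j : Fin g) × Fin (m j)) = ⟨cls k', idx k'⟩ at h1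
      rw [← he, ← he] at h1
      obtain rfl := e.injective h1
      simpa [f] using hx
    · rintro ⟨j, a, x⟩
      obtain ⟨k, hk⟩ := e.surjective ⟨j, a⟩
      rw [he] at hk
      cases hk
      exact ⟨⟨k, x⟩, rfl⟩
  refine gaugeEquiv_of_submatrix (Equiv.ofBijective f hf) fun o i => ?_
  ext ⟨k, x⟩ ⟨k', x'⟩
  by_cases hk : k = k'
  · subst hk
    simp [f, multSum, Matrix.blockDiagonal'_apply_eq]
  · rw [Matrix.blockDiagonal'_apply_ne _ _ _ hk]
    refine (multSum_apply_ne _ _ _ _ _ _ _ fun h' => hk ?_).symm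
    exact e.injective ((he k).trans (h'.trans (he k').symm))

end directSum

/-- The weight is absorbed into the block, so a canonical form is directly a sum of irreducible
families. A zero tensor is excluded because its transfer matrix lacks the eigenvalue `1`; an
invariant subspace is tested by the projection along any complement. -/
theorem IsNormal.isIrredFamily_smul {b O I : Type*} [Fintype b] [DecidableEq b] [Fintype O]
    [Fintype I] {A : MPOTensor b O I} (h : A.IsNormal) {μ : ℂ} (hμ : μ ≠ 0) :
    IsIrredFamily (MPOTensor.flat fun o i => μ • A o i) := by
  obtain ⟨hP, hroot, -⟩ := h
  constructor
  · by_contra! hcon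
    have h0 : A.transfer = 0 := by
      have : ∀ o i, A o i = 0 := fun o i => (smul_eq_zero.1 (hcon (o, i))).resolve_left hμ
      ext x y
      simp [transfer, double, this]
    rw [h0, Polynomial.rootMultiplicity_eq_zero] at hroot
    · exact zero_ne_one hroot
    · simp [Matrix.charpoly_zero]
  · intro p hp
    obtain ⟨q, hpq⟩ := p.exists_isCompl
    let P := LinearMap.toMatrix' (p.projection q hpq)
    have hPv : ∀ v, P *ᵥ v = p.projection q hpq v := fun v => by
      rw [← Matrix.toLin'_apply, Matrix.toLin'_toMatrix']
    have hmem : ∀ v, P *ᵥ v ∈ p := fun v => by rw [hPv]; exact Submodule.projection_apply_mem hpq v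
    have hfix : ∀ v ∈ p, P *ᵥ v = v := fun v hv => by
      rw [hPv]; exact Submodule.projection_apply_of_mem_left hpq hv
    have hidem : IsIdempotentElem P := by
      refine Matrix.mulVec_injective (funext fun v => ?_)
      rw [← Matrix.mulVec_mulVec, hfix _ (hmem v)]
    rcases hP P hidem fun o i => by
      refine Matrix.mulVec_injective (funext fun v => ?_)
      rw [Matrix.mul_assoc, ← Matrix.mulVec_mulVec v P, hfix]
      rw [← Matrix.mulVec_mulVec]
      have := p.smul_mem μ⁻¹ (hp (o, i) _ (hmem v))
      rwa [MPOTensor.flat, Matrix.smul_mulVec, smul_smul, inv_mul_cancel₀ hμ, one_smul] at this with h | h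
    · left
      rw [eq_bot_iff]
      intro v hv
      rw [← hfix v hv, h]; simp
    · right
      rw [eq_top_iff]
      intro v _
      have := hmem v
      rwa [h, Matrix.one_mulVec] at this

end MPOTensor

/-! ### Gauge classes and the structure of scaled isometries. -/

theorem Setoid.exists_fin_classes {ι : Type*} [Fintype ι] (r : Setoid ι) :
    ∃ (g : ℕ) (cls : ι → Fin g) (rep : Fin g → ι), (∀ j, cls (rep j) = j) ∧
      ∀ k l, cls k = cls l ↔ r k l := by
  classical
  let e := Fintype.equivFin (Quotient r)
  refine ⟨_, fun k => e (Quotient.mk r k), fun j => (e.symm j).out, fun j => by simp, fun k l => ?_⟩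
  rw [e.injective.eq_iff, Quotient.eq]

theorem sum_comp_eq_sum_card_mul {ι R : Type*} [Fintype ι] [Semiring R] {g : ℕ} (cls : ι → Fin g)
    (F : Fin g → R) : ∑ k, F (cls k) = ∑ j, (Fintype.card {k // cls k = j} : R) * F j := by
  rw [← Fintype.sum_fiberwise' cls F]
  simp [nsmul_eq_mul]

namespace MPOTensor
variable {b b' O I : Type*} [Fintype b] [DecidableEq b] [Fintype b'] [DecidableEq b']

theorem GaugeEquiv.refl (A : MPOTensor b O I) : GaugeEquiv A A :=
  ⟨1, 1, by simp, by simp, by simp⟩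

theorem GaugeEquiv.symm {A : MPOTensor b O I} {B : MPOTensor b' O I} (h : GaugeEquiv A B) :
    GaugeEquiv B A := by
  obtain ⟨X, Y, hXY, hYX, hA⟩ := h
  refine ⟨Y, X, hYX, hXY, fun o i => ?_⟩
  rw [hA]
  simp only [← Matrix.mul_assoc]
  rw [hYX, Matrix.one_mul, Matrix.mul_assoc, hYX, Matrix.mul_one]

theorem word_block (A : MPOTensor b O I) {q N : ℕ} (o : Fin N → Fin q → O) (i : Fin N → Fin q → I) :
    (A.block q).word o i =
      wprod A.flat (List.ofFn fun s => List.ofFn fun t => (o s t, i s t)).flatten := by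
  rw [word, wprod, List.map_flatten, List.prod_flatten, List.map_ofFn, List.map_ofFn]
  congr 2
  funext s
  exact word_eq_wprod _ _ _

theorem ofFn_flatten_ne_nil {α : Type*} {q N : ℕ} (hq : 0 < q) (hN : 1 ≤ N)
    (f : Fin N → Fin q → α) : (List.ofFn fun s => List.ofFn fun t => f s t).flatten ≠ [] := by
  rw [Ne, List.flatten_eq_nil_iff]
  intro h
  have := h (List.ofFn (f ⟨0, hN⟩)) (by rw [List.mem_ofFn]; exact ⟨_, rfl⟩)
  rw [List.ofFn_eq_nil_iff] at this
  omega

theorem conjTranspose_mpo_block_mul [Fintype O] (A : MPOTensor b O I) (B : MPOTensor b' O I)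
    {q N : ℕ} (i i' : Fin N → Fin q → I) :
    (((A.block q).mpo N)ᴴ * (B.block q).mpo N) i i' =
      (wprod (fun s : I × I => double A B s.1 s.2)
        (List.ofFn fun s => List.ofFn fun t => (i s t, i' s t)).flatten).trace := by
  rw [conjTranspose_mpo_mul_mpo_eq_wprod, wprod, wprod, List.map_flatten, List.prod_flatten,
    List.map_ofFn, List.map_ofFn, List.map_ofFn]
  congr 3
  funext s
  exact double_block _ _ _ _

theorem prod_map_flatten_ite {R : Type*} [CommSemiring R] [DecidableEq I] {q N : ℕ}
    (i i' : Fin N → Fin q → I) :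
    ((List.ofFn fun s => List.ofFn fun t => (i s t, i' s t)).flatten.map
      fun s : I × I => if s.1 = s.2 then (1 : R) else 0).prod = if i = i' then 1 else 0 := by
  rw [List.map_flatten, List.prod_flatten, List.map_ofFn, List.map_ofFn, List.prod_ofFn]
  simp only [Function.comp_def, List.map_ofFn, List.prod_ofFn, Finset.prod_ite_zero,
    Finset.prod_const_one, Finset.mem_univ, true_imp_iff, funext_iff]

variable {ι : Type} [Fintype ι] {d : ι → ℕ} {A : (k : ι) → MPOTensor (Fin (d k)) O I}

/-- The entries of `V_N† V_N = c 1` are traces of words in double tensors, and an entry of the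
identity is a product of Kronecker deltas: this is the trace hypothesis of the free algebra
principle. -/
theorem sum_trace_wprod_double [Fintype O] [DecidableEq I] {V : MPOTensor b O I} {c : ℝ}
    (hV : V.IsSMPI c)
    (hVA : ∀ l : List (O × I), l ≠ [] →
      (wprod V.flat l).trace = ∑ k, (wprod (A k).flat l).trace)
    (l : List (I × I)) (hl : l ≠ []) :
    ∑ p : ι × ι, (wprod (fun s : I × I => double (A p.1) (A p.2) s.1 s.2) l).trace =
      (c : ℂ) * (l.map fun s : I × I => if s.1 = s.2 then (1 : ℂ) else 0).prod := by
  obtain ⟨N, i, i', rfl⟩ : ∃ (N : ℕ) (i i' : Fin N → I), l = List.ofFn fun s => (i s, i' s) :=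
    ⟨l.length, fun s => (l.get s).1, fun s => (l.get s).2, by simp⟩
  have hN : 1 ≤ N := by
    rcases Nat.eq_zero_or_pos N with rfl | h
    · simp at hl
    · exact h
  have hmpo : V.mpo N = ∑ k, (A k).mpo N := by
    ext o i
    simp only [mpo, word_eq_wprod, Matrix.sum_apply]
    refine hVA _ fun h => ?_
    rw [List.ofFn_eq_nil_iff] at h
    omega
  have h1 := congrFun (congrFun (hV.2 N hN) i) i'
  rw [hmpo, Matrix.conjTranspose_sum, Matrix.sum_mul] at h1
  simp only [Matrix.mul_sum, Matrix.sum_apply, conjTranspose_mpo_mul_mpo_eq_wprod] at h1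
  rw [Fintype.sum_prod_type, h1, Matrix.smul_apply, smul_eq_mul, Matrix.one_apply, List.map_ofFn,
    List.prod_ofFn]
  congr 1
  simp only [Function.comp_def, Finset.prod_ite_zero, Finset.prod_const_one, Finset.mem_univ,
    true_imp_iff, funext_iff]

/-- The weights on pairs of input values that turn the double tensor into the transfer matrix. -/
noncomputable def diagWeight (I : Type*) [Fintype I] [DecidableEq I] : I × I → ℂ :=
  fun s => if s.1 = s.2 then (Fintype.card I : ℂ)⁻¹ else 0

omit [Fintype b] [DecidableEq b] [Fintype b'] [DecidableEq b'] in
theorem sum_diagWeight_smul [Fintype O] [Fintype I] [DecidableEq I] (A : MPOTensor b O I)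
    (B : MPOTensor b' O I) :
    ∑ s : I × I, diagWeight I s • double A B s.1 s.2 = mixedTransfer A B := by
  rw [Fintype.sum_prod_type, mixedTransfer, Finset.smul_sum]
  refine Finset.sum_congr rfl fun i _ => ?_
  rw [Finset.sum_eq_single i]
  · simp [diagWeight]
  · intro i' _ h; simp [diagWeight, h.symm]
  · simp

theorem sum_diagWeight_mul [Fintype I] [DecidableEq I] [Nonempty I] :
    ∑ s : I × I, diagWeight I s * (if s.1 = s.2 then (1 : ℂ) else 0) = 1 := by
  rw [Fintype.sum_prod_type]
  simp [diagWeight]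

/-- The trace of the mixed transfer matrix depends only on the traces of single letters, which are
gauge invariant. -/
theorem trace_mixedTransfer_congr [Fintype O] [Fintype I] {A : MPOTensor b O I}
    {B : MPOTensor b' O I} (h : GaugeEquiv A B) :
    (mixedTransfer A B).trace = (mixedTransfer A A).trace := by
  have ht : ∀ o i, (B o i).trace = (A o i).trace := fun o i => by
    have := h.trace_wprod [(o, i)]
    simp only [wprod_singleton] at this
    exact this.symm
  simp only [mixedTransfer, double, Matrix.trace_smul, Matrix.trace_sum, Matrix.trace_kronecker, ht]

theorem linearIndependent_of_orthonormal {κ m n : Type*} [Fintype κ] [DecidableEq κ] [Fintype m]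
    [DecidableEq n] [Nonempty n] {B : κ → Matrix m n ℂ}
    (h : ∀ j j', (B j)ᴴ * B j' = if j = j' then 1 else 0) : LinearIndependent ℂ B := by
  rw [Fintype.linearIndependent_iff]
  intro f hf j
  have h1 := congrArg (fun M => (B j)ᴴ * M) hf
  simp only [Matrix.mul_sum, Matrix.mul_smul, h, Matrix.mul_zero] at h1
  rw [Finset.sum_eq_single j (fun j' _ hj => by rw [if_neg hj.symm, smul_zero]) (by simp),
    if_pos rfl] at h1
  obtain ⟨x⟩ := ‹Nonempty n›
  simpa using congrFun (congrFun h1 x) x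

/-- The structure of a scaled isometry whose operators are a sum of those of irreducible tensors. -/
theorem IsSMPI.exists_bnt [Fintype O] [Fintype I] [DecidableEq I] [Nonempty I] {D : ℕ}
    {V : MPOTensor (Fin D) O I} {c : ℝ} (hV : V.IsSMPI c)
    (hirr : ∀ k, IsIrredFamily (A k).flat) (hd : ∑ k, d k ≤ D)
    (hVA : ∀ l : List (O × I), l ≠ [] →
      (wprod V.flat l).trace = ∑ k, (wprod (A k).flat l).trace) [DecidableEq ι] :
    ∃ (q : ℕ) (g : ℕ) (m dW : Fin g → ℕ)
      (W : (j : Fin g) → MPOTensor (Fin (dW j)) (Fin q → O) (Fin q → I)),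
      0 < q ∧ g ≤ D ∧ (∀ j, 0 < m j) ∧ ∑ j, m j * dW j ≤ D ∧
      (∀ N : ℕ, 1 ≤ N → (V.block q).mpo N = (multSum m dW W).mpo N) ∧
      (GaugeEquiv V (fun o i => Matrix.blockDiagonal' fun k => A k o i) →
        GaugeEquiv (V.block q) (multSum m dW W)) ∧
      IsBNT W (V.block q) ∧
      (∀ j j', j ≠ j' → StronglyOrthogonal (W j) (W j')) ∧
      ∑ j, (m j : ℝ) ^ 2 = c ∧
      (∀ N : ℕ, 1 ≤ N → ∀ j j', ((W j).mpo N)ᴴ * (W j').mpo N = if j = j' then 1 else 0) := by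
  set κ : ℝ := (Fintype.card I : ℝ)⁻¹ with hκdef
  have hκ : 0 < κ := by positivity
  have hprin := sum_trace_wprod_double hV hVA
  have hspec := fun p : ι × ι => average_spectrum (diagWeight I) sum_diagWeight_mul hprin p
  have htrw := fun p : ι × ι => trace_wprod_eq (diagWeight I) sum_diagWeight_mul hprin p
  simp only [sum_diagWeight_smul] at hspec htrw
  have hne : ∀ k, Nonempty (Fin (d k)) := by
    intro k
    by_contra hemp
    rw [not_nonempty_iff] at hemp
    obtain ⟨s, hs⟩ := (hirr k).1
    exact hs (Subsingleton.elim _ _)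
  have hfull : ∀ k, IsFullFamily (A k).flat := fun k => (hirr k).span_wprod_eq_top
  have hstab : ∀ k, ∃ a, 1 ≤ a ∧ IsStableFamily κ (A k).flat a := by
    intro k
    have h1 := hspec (k, k)
    simp only [mixedTransfer_eq_krausMatrix] at h1
    exact (hfull k).exists_isStableFamily hκ h1.1 h1.2
  choose a ha1 ha using hstab
  -- the traces of the mixed transfer matrices
  have hτ1 : ∀ k l, GaugeEquiv (A k) (A l) → (mixedTransfer (A k) (A l)).trace = 1 := by
    intro k l hkl
    rw [trace_mixedTransfer_congr hkl, ← (hspec (k, k)).2 (a k) (ha1 k), mixedTransfer_eq_krausMatrix]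
    exact (ha k).trace_pow
  have hτ0 : ∀ k l, ¬ GaugeEquiv (A k) (A l) → (mixedTransfer (A k) (A l)).trace = 0 := by
    intro k l hkl
    have h1 := (hspec (k, l)).1
    simp only [mixedTransfer_eq_krausMatrix] at h1 ⊢
    refine trace_krausMatrix_eq_zero (ha k) (ha l) h1 ?_
    rintro ⟨Y, Y', h2, h3, h4⟩
    refine hkl ⟨Y', Y, h2, h3, fun o i => ?_⟩
    have := h4 (o, i)
    change Y * A k o i = A l o i * Y at this
    rw [Matrix.mul_assoc, ← this, ← Matrix.mul_assoc, h2, Matrix.one_mul]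
  obtain ⟨g, cls, rep, hrep, hcls⟩ := Setoid.exists_fin_classes (ι := ι)
    ⟨fun k l => GaugeEquiv (A k) (A l), fun k => .refl _, fun h => h.symm, fun h h' => h.trans h'⟩
  replace hcls : ∀ k l, cls k = cls l ↔ GaugeEquiv (A k) (A l) := hcls
  have hgauge : ∀ k, GaugeEquiv (A k) (A (rep (cls k))) := fun k => (hcls _ _).1 (hrep _).symm
  have hτ : ∀ k l, (mixedTransfer (A k) (A l)).trace = if cls k = cls l then 1 else 0 := by
    intro k l
    split_ifs with h
    · exact hτ1 k l ((hcls k l).1 h)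
    · exact hτ0 k l fun h' => h ((hcls k l).2 h')
  -- the blocking length
  have hnilq : ∀ p : ι × ι, ∃ q, cls p.1 ≠ cls p.2 → ∀ l : List (I × I), q ≤ l.length →
      wprod (fun s : I × I => double (A p.1) (A p.2) s.1 s.2) l = 0 := by
    intro p
    by_cases h : cls p.1 = cls p.2
    · exact ⟨0, fun h' => absurd h h'⟩
    · obtain ⟨q, hq⟩ := exists_wprod_eq_zero _ fun l hl => by
        rw [htrw p l hl, hτ, if_neg h, mul_zero]
      exact ⟨q, fun _ => hq⟩
  choose b hb using hnilq
  -- A common upper bound for all stabilization exponents and all vanishing lengths; the `1` keeps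
  -- it positive when there are no blocks.
  set q := 1 + (∑ k, a k + ∑ p, b p) with hq
  have hqa : ∀ k, a k ≤ q := fun k => by
    have := Finset.single_le_sum (f := a) (fun _ _ => Nat.zero_le _) (Finset.mem_univ k)
    omega
  have hqb : ∀ p, b p ≤ q := fun p => by
    have := Finset.single_le_sum (f := b) (fun _ _ => Nat.zero_le _) (Finset.mem_univ p)
    omega
  have hq0 : 0 < q := by omega
  have hstabq : ∀ k, IsStableFamily κ (A k).flat q := fun k => (ha k).of_le (hqa k)
  let m : Fin g → ℕ := fun j => Fintype.card {k // cls k = j}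
  let W : (j : Fin g) → MPOTensor (Fin (d (rep j))) (Fin q → O) (Fin q → I) :=
    fun j => (A (rep j)).block q
  have hm : ∀ j, 0 < m j := fun j => Fintype.card_pos_iff.2 ⟨⟨rep j, hrep j⟩⟩
  have hmd : ∑ j, m j * d (rep j) ≤ D := by
    refine le_trans (le_of_eq ?_) hd
    have h1 := sum_comp_eq_sum_card_mul cls fun j => d (rep j)
    simp only [Nat.cast_id] at h1
    rw [← h1]
    refine Finset.sum_congr rfl fun k _ => ?_
    simpa using (hgauge k).card_eq.symm
  have hmpo : ∀ N, 1 ≤ N → (V.block q).mpo N = ∑ j, (m j : ℂ) • (W j).mpo N := by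
    intro N hN
    ext o i
    simp only [mpo, word_block, W, Matrix.sum_apply, Matrix.smul_apply, smul_eq_mul]
    set l := (List.ofFn fun s => List.ofFn fun t => (o s t, i s t)).flatten with hl
    rw [hVA l (ofFn_flatten_ne_nil hq0 hN fun s t => (o s t, i s t)),
      ← sum_comp_eq_sum_card_mul cls fun j => (wprod (A (rep j)).flat l).trace]
    exact Finset.sum_congr rfl fun k _ => (hgauge k).trace_wprod l
  have horth : ∀ N, 1 ≤ N → ∀ j j', ((W j).mpo N)ᴴ * (W j').mpo N = if j = j' then 1 else 0 := by
    intro N hN j j'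
    ext i i'
    rw [conjTranspose_mpo_block_mul, htrw (rep j, rep j') _
      (ofFn_flatten_ne_nil hq0 hN fun s t => (i s t, i' s t)), prod_map_flatten_ite, hτ,
      hrep, hrep]
    by_cases hj : j = j'
    · rw [if_pos hj, if_pos hj, mul_one, Matrix.one_apply]
    · rw [if_neg hj, if_neg hj, mul_zero, Matrix.zero_apply]
  refine ⟨q, g, m, fun j => d (rep j), W, hq0, ?_, hm, hmd, ?_, ?_, ⟨?_, ?_, 0, ?_⟩, ?_, ?_, horth⟩
  · refine le_trans ?_ hmd
    calc g = ∑ _j : Fin g, 1 := by simp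
      _ ≤ _ := Finset.sum_le_sum fun j _ =>
        Nat.mul_pos (hm j) (Fin.pos_iff_nonempty.2 (hne (rep j)))
  · intro N hN
    rw [hmpo N hN, mpo_multSum]
  · intro h
    have := (h.trans (gaugeEquiv_multSum (B := fun j => A (rep j)) cls hgauge)).block q
    rwa [block_multSum] at this
  · exact fun j => isNormal_block (hstabq (rep j))
  · intro N hN
    rw [hmpo N hN]
    exact Submodule.sum_mem _ fun j _ => Submodule.smul_mem _ _ (Submodule.subset_span ⟨j, rfl⟩)
  · intro N hN
    exact linearIndependent_of_orthonormal (horth N hN)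
  · intro j j' hj i i'
    rw [double_block]
    refine hb (rep j, rep j') (by simpa [hrep] using hj) _ ?_
    simpa using hqb _
  · obtain ⟨i₀⟩ := ‹Nonempty I›
    -- On one diagonal letter the trace identity says that `c` counts the pairs of blocks in the
    -- same class, which is the sum of the squared class sizes.
    have h1 := hprin [(i₀, i₀)] (by simp)
    simp only [htrw _ [(i₀, i₀)] (by simp), hτ] at h1
    rw [Fintype.sum_prod_type] at h1
    simp only [List.map_cons, List.map_nil, List.prod_cons, List.prod_nil, if_true, one_mul,
      mul_one] at h1
    have h2 : ∀ k, ∑ l, (if cls k = cls l then (1 : ℂ) else 0) = m (cls k) := by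
      intro k
      rw [sum_comp_eq_sum_card_mul cls fun j => if cls k = j then (1 : ℂ) else 0]
      simp [m]
    simp only [h2] at h1
    rw [sum_comp_eq_sum_card_mul cls fun j => (m j : ℂ)] at h1
    have h3 : ((∑ j, (m j : ℝ) ^ 2 : ℝ) : ℂ) = (c : ℂ) := by
      rw [← h1]; push_cast; simp [m, sq]
    exact_mod_cast h3

end MPOTensor

end

theorem mainTheorem4 (D dOut χ dIn : ℕ) (hIn : 0 < dIn)
    (V : MPOTensor (Fin D) (Fin dOut × Fin χ) (Fin dIn)) (c : ℝ) (hV : V.IsSMPI c) :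
    ∃ (q : ℕ) (g : ℕ) (m d : Fin g → ℕ)
      (W : (j : Fin g) → MPOTensor (Fin (d j)) (Fin q → Fin dOut × Fin χ) (Fin q → Fin dIn)),
      0 < q ∧ g ≤ D ∧ (∀ j, 0 < m j) ∧ ∑ j, m j * d j ≤ D ∧
      -- `V_q` and `⊕_j (1_{m_j} ⊗ W_j)` generate the same operators for every system size
      (∀ N : ℕ, 1 ≤ N → (V.block q).mpo N = (MPOTensor.multSum m d W).mpo N) ∧
      -- and agree as tensors, up to a gauge, when `V` is in canonical form
      (V.HasCanonicalForm → MPOTensor.GaugeEquiv (V.block q) (MPOTensor.multSum m d W)) ∧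
      MPOTensor.IsBNT W (V.block q) ∧
      (∀ j j', j ≠ j' → MPOTensor.StronglyOrthogonal (W j) (W j')) ∧
      (∀ j, (W j).IsHMPI) ∧
      ∑ j, (m j : ℝ) ^ 2 = c ∧
      (∀ N : ℕ, 1 ≤ N →
        ((√c)⁻¹ : ℂ) • (V.block q).mpo N = ((√c)⁻¹ : ℂ) • ∑ j, (m j : ℂ) • (W j).mpo N) ∧
      (∀ N : ℕ, 1 ≤ N → ∀ j j',
        ((W j).mpo N).conjTranspose * (W j').mpo N = if j = j' then 1 else 0) := by
  have : Nonempty (Fin dIn) := ⟨⟨0, hIn⟩⟩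
  obtain ⟨ι, _, _, d, A, hirr, hd, hVA, hcan⟩ : ∃ (ι : Type) (_ : Fintype ι)
      (_ : DecidableEq ι) (d : ι → ℕ)
      (A : (k : ι) → MPOTensor (Fin (d k)) (Fin dOut × Fin χ) (Fin dIn)),
      (∀ k, IsIrredFamily (A k).flat) ∧ ∑ k, d k ≤ D ∧
      (∀ l, l ≠ [] → (wprod V.flat l).trace = ∑ k, (wprod (A k).flat l).trace) ∧
      (V.HasCanonicalForm → MPOTensor.GaugeEquiv V
        fun o i => Matrix.blockDiagonal' fun k => A k o i) := by
    -- Triangularization preserves only traces, so the gauge statement requires starting from the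
    -- given canonical blocks whenever they exist.
    by_cases hc : V.HasCanonicalForm
    · obtain ⟨r, d, μ, B, hμ, hB, hg⟩ := hc
      refine ⟨Fin r, inferInstance, inferInstance, d, fun k o i => μ k • B k o i,
        fun k => (hB k).isIrredFamily_smul (hμ k), ?_, fun l _ => ?_, fun _ => hg⟩
      · have := hg.card_eq
        simp at this
        exact this.ge
      · rw [hg.trace_wprod l,
          MPOTensor.wprod_blockDiagonal' (fun k o i => μ k • B k o i), Matrix.trace_blockDiagonal']
    · obtain ⟨ι, hι, d, B, hB, hd, ht⟩ := exists_irreducible_decomposition D V.flat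
      exact ⟨ι, hι, Classical.decEq ι, d, fun k o i => B k (o, i), hB, hd, ht, fun h => absurd h hc⟩
  obtain ⟨q, g, m, dW, W, h1, h2, h3, h4, h5, h6, h7, h8, h9, h10⟩ := hV.exists_bnt hirr hd hVA
  refine ⟨q, g, m, dW, W, h1, h2, h3, h4, h5, fun h => h6 (hcan h), h7, h8, ?_, h9, ?_, h10⟩
  · intro j N hN
    simpa using h10 N hN j j
  · intro N hN
    rw [h5 N hN, MPOTensor.mpo_multSum]
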